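/- Let $\Gamma$ be a discrete i.c.c. group, i.e. an infinite group in which every element $g\neq e$ has an infinite conjugacy class. Let $\mathcal A$ be a unital $C^*$-algebra with an action of $\Gamma$ by $*$-automorphisms, $\mathcal A\neq\mathbb C$, and suppose that $\mathcal A$ has a faithful $\Gamma$-invariant state $\varphi$. Let $\pi:\mathcal A\to B(\mathcal H)$ be a faithful unital $*$-representation, and on $\ell^2(\Gamma,\mathcal H)$ put $(\lambda_s\xi)(t)=\xi(s^{-1}t)$ and $(\sigma(a)\xi)(t)=\pi(t^{-1}a)\xi(t)$. Let $\mathcal A\rtimes_r\Gamma\subset B(\ell^2(\Gamma,\mathcal H))$ be the $C^*$-algebra generated by all $\sigma(a)$ and $\lambda_s$, let $C^*_r(\Gamma)\subset\mathcal A\rtimes_r\Gamma$ be the $C^*$-subalgebra generated by all $\lambda_s$, identify $\mathcal A$ with $\sigma(\mathcal A)$, and let $\mathbb E:\mathcal A\rtimes_r\Gamma\to\mathcal A$ be the canonical conditional expectation, i.e. the continuous linear map with $\mathbb E(\sigma(a)\lambda_s)=a$ if $s=e$ and $0$ if $s\ne e$. Let $I$ be a closed two-sided ideal of $C^*_r(\Gamma)$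 with $0\neq I\neq C^*_r(\Gamma)$, and put $$\mathcal A_I=\operatorname{span}\{\eta x\eta' : \eta,\eta'\in I,\ x\in\mathcal A\rtimes_r\Gamma\},\qquad \mathcal B=C^*_r(\Gamma)+\overline{\mathcal A_I}.$$ Then: 1. $\mathcal B$ is a (norm closed) $C^*$-algebra and $C^*_r(\Gamma)\subsetneq\mathcal B\subsetneq\mathcal A\rtimes_r\Gamma$; 2. $\mathcal B\cap\mathcal A=\mathbb C1$; 3. $\mathbb E(\mathcal A_I)$, and hence $\mathbb E(\mathcal B)$, is norm dense in $\mathcal A$; 4. consequently $\mathcal B$ is not a crossed product in the canonical way: there is no $\Gamma$-invariant $C^*$-subalgebra $\mathcal S\subset\mathcal A$ with $\mathcal B=\mathcal S\rtimes_r\Gamma$, where $\mathcal S\rtimes_r\Gamma$ is the closed linear span of $\{\sigma(b)\lambda_s : b\in\mathcal S,\ s\in\Gamma\}$. -/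

import Mathlib

open scoped ENNReal ComplexOrder

noncomputable section

/-- An i.c.c. group: an infinite group in which every nontrivial conjugacy class is infinite. -/
def IsICC (Γ : Type*) [Group Γ] : Prop :=
  Infinite Γ ∧ ∀ g : Γ, g ≠ 1 → (conjugatesOf g).Infinite

/-- The Hilbert space `ℓ²(Γ, H)` of square summable `H`-valued functions on `Γ`. -/
abbrev EllTwo (Γ H : Type*) [NormedAddCommGroup H] := lp (fun _ : Γ => H) 2

set_option linter.unusedSectionVars false

section Regular

variable (Γ : Type*) [Group Γ]
variable (H : Type*) [NormedAddCommGroup H] [InnerProductSpace ℂ H] [CompleteSpace H]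

/-- The operator `λ_s` on `ℓ²(Γ, H)`: `(λ_s ξ)(t) = ξ(s⁻¹t)`. -/
def translationOp (s : Γ) : EllTwo Γ H →L[ℂ] EllTwo Γ H :=
  LinearMap.mkContinuous
    { toFun := fun ξ => ⟨fun t => ξ (s⁻¹ * t), memℓp_gen (by
        have h := (lp.memℓp ξ).summable (by simp)
        exact (Equiv.mulLeft s⁻¹).summable_iff.mpr h)⟩
      map_add' := fun ξ η => by ext t; simp; rfl
      map_smul' := fun c ξ => by ext t; simp }
    1 (fun ξ => by
      rw [one_mul]
      refine lp.norm_le_of_tsum_le (by simp) (norm_nonneg _) ?_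
      rw [lp.norm_rpow_eq_tsum (by simp) ξ]
      exact ((Equiv.mulLeft s⁻¹).tsum_eq
        (fun t => ‖ξ t‖ ^ (2 : ℝ≥0∞).toReal)).le)

variable {Γ H} in
@[simp] theorem translationOp_apply (s : Γ) (ξ : EllTwo Γ H) (t : Γ) :
    translationOp Γ H s ξ t = ξ (s⁻¹ * t) := rfl

/-- The left regular representation `λ` of `Γ` on `ℓ²(Γ, H)`. -/
def leftReg : Γ →* (EllTwo Γ H →L[ℂ] EllTwo Γ H) where
  toFun := translationOp Γ H
  map_one' := by ext ξ t; simp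
  map_mul' s s' := by ext ξ t; simp [mul_assoc]

variable {Γ H} in
@[simp] theorem leftReg_apply (s : Γ) (ξ : EllTwo Γ H) (t : Γ) :
    leftReg Γ H s ξ t = ξ (s⁻¹ * t) := rfl

variable {Γ H} in
theorem star_leftReg (s : Γ) : star (leftReg Γ H s) = leftReg Γ H s⁻¹ := by
  rw [ContinuousLinearMap.star_eq_adjoint, eq_comm, ContinuousLinearMap.eq_adjoint_iff]
  intro ξ η
  rw [lp.inner_eq_tsum, lp.inner_eq_tsum, ← (Equiv.mulLeft s).tsum_eq (fun i => inner ℂ (ξ i) _)]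
  refine tsum_congr fun t => ?_
  simp

/-- The reduced group C⋆-algebra `C⋆_r(Γ)`: the C⋆-algebra generated by the operators `λ_s`
on `ℓ²(Γ, H)`. For `H = ℂ` this is literally the algebra generated by the left regular
representation on `ℓ²(Γ)`; for general `H ≠ 0` it is its canonical copy `C⋆_r(Γ) ⊗ 1` inside
the reduced crossed products on `ℓ²(Γ, H)`. -/
def reducedGroupCStar : StarSubalgebra ℂ (EllTwo Γ H →L[ℂ] EllTwo Γ H) :=
  (StarAlgebra.adjoin ℂ (Set.range (leftReg Γ H))).topologicalClosure

end Regular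

section CrossedProduct

variable {Γ : Type*} [Group Γ] {A : Type*} [CStarAlgebra A] (α : Γ →* (A ≃⋆ₐ[ℂ] A))
variable {H : Type*} [NormedAddCommGroup H] [InnerProductSpace ℂ H] [CompleteSpace H]
variable (π : A →⋆ₐ[ℂ] (H →L[ℂ] H))

theorem norm_rep_apply_le (g : Γ) (a : A) (v : H) : ‖π (α g a) v‖ ≤ ‖a‖ * ‖v‖ := by
  refine (ContinuousLinearMap.le_opNorm _ _).trans ?_
  gcongr
  exact (NonUnitalStarAlgHom.norm_apply_le π _).trans (NonUnitalStarAlgHom.norm_apply_le (α g) _)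

/-- The operator `σ(a)` on `ℓ²(Γ, H)`: `(σ(a) ξ)(t) = π(t⁻¹ • a) ξ(t)`. -/
def sigmaOp (a : A) : EllTwo Γ H →L[ℂ] EllTwo Γ H :=
  LinearMap.mkContinuous
    { toFun := fun ξ => ⟨fun t => π (α t⁻¹ a) (ξ t), by
        refine Memℓp.mono' (g := fun t => ‖a‖ • ξ t) ((lp.memℓp ξ).const_smul ‖a‖) fun t => ?_
        rw [norm_smul, norm_norm]
        exact norm_rep_apply_le α π t⁻¹ a (ξ t)⟩
      map_add' := fun ξ η => by ext t; simp; rfl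
      map_smul' := fun c ξ => by ext t; simp }
    ‖a‖ (fun ξ => by
      have h : ‖(‖a‖ : ℝ) • ξ‖ = ‖a‖ * ‖ξ‖ := by rw [norm_smul, norm_norm]
      rw [← h]
      refine lp.norm_mono (by simp) fun t => ?_
      refine (norm_rep_apply_le α π t⁻¹ a (ξ t)).trans (le_of_eq ?_)
      rw [lp.coeFn_smul, Pi.smul_apply]
      exact ((norm_smul _ _).trans (by rw [norm_norm])).symm)

@[simp] theorem sigmaOp_apply (a : A) (ξ : EllTwo Γ H) (t : Γ) :
    sigmaOp α π a ξ t = π (α t⁻¹ a) (ξ t) := rfl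

/-- The `*`-representation `σ : A → B(ℓ²(Γ, H))`. -/
def sigma : A →⋆ₐ[ℂ] (EllTwo Γ H →L[ℂ] EllTwo Γ H) where
  toFun := sigmaOp α π
  map_one' := by ext ξ t; simp
  map_mul' a b := by ext ξ t; simp
  map_zero' := by ext ξ t; simp
  map_add' a b := by ext ξ t; simp
  commutes' c := by ext ξ t; simp [Algebra.algebraMap_eq_smul_one]
  map_star' a := by
    rw [ContinuousLinearMap.star_eq_adjoint, ContinuousLinearMap.eq_adjoint_iff]
    intro ξ η
    rw [lp.inner_eq_tsum, lp.inner_eq_tsum]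
    refine tsum_congr fun t => ?_
    simp only [sigmaOp_apply, map_star, ContinuousLinearMap.star_eq_adjoint,
      ContinuousLinearMap.adjoint_inner_left]

@[simp] theorem sigma_apply (a : A) (ξ : EllTwo Γ H) (t : Γ) :
    sigma α π a ξ t = π (α t⁻¹ a) (ξ t) := rfl

/-- Covariance: `λ_s σ(a) = σ(s • a) λ_s`. -/
theorem leftReg_mul_sigma (s : Γ) (a : A) :
    leftReg Γ H s * sigma α π a = sigma α π (α s a) * leftReg Γ H s := by
  ext ξ t
  have h : α t⁻¹ (α s a) = α (t⁻¹ * s) a := by rw [map_mul]; rfl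
  simp only [mul_apply_eq_comp, leftReg_apply, sigma_apply, h, mul_inv_rev, inv_inv]

/-- The reduced crossed product `A ⋊_r Γ`: the closure in `B(ℓ²(Γ, H))` of the `*`-algebra
generated by the operators `σ(a)` and `λ_s`. -/
def reducedCrossedProduct : StarSubalgebra ℂ (EllTwo Γ H →L[ℂ] EllTwo Γ H) :=
  (StarAlgebra.adjoin ℂ (Set.range (sigma α π) ∪ Set.range (leftReg Γ H))).topologicalClosure

/-- The reduced crossed product `S ⋊_r Γ ⊆ A ⋊_r Γ` of a (not necessarily unital) `Γ`-invariant
`*`-subalgebra `S` of `A`: the closed linear span of the operators `σ(b) λ_s` with `b ∈ S` and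
`s ∈ Γ`. -/
def subCrossedProduct (S : NonUnitalStarSubalgebra ℂ A) :
    Submodule ℂ (EllTwo Γ H →L[ℂ] EllTwo Γ H) :=
  (Submodule.span ℂ {T | ∃ b ∈ S, ∃ s : Γ, T = sigma α π b * leftReg Γ H s}).topologicalClosure

/-- The algebraic crossed product is the linear span of the operators `σ(a) λ_s`. -/
theorem adjoin_eq_span :
    ((StarAlgebra.adjoin ℂ (Set.range (sigma α π) ∪ Set.range (leftReg Γ H)) :
        StarSubalgebra ℂ (EllTwo Γ H →L[ℂ] EllTwo Γ H)) : Set (EllTwo Γ H →L[ℂ] EllTwo Γ H)) =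
      (Submodule.span ℂ {T | ∃ b ∈ (⊤ : NonUnitalStarSubalgebra ℂ A), ∃ s : Γ,
        T = sigma α π b * leftReg Γ H s} : Submodule ℂ (EllTwo Γ H →L[ℂ] EllTwo Γ H)) := by
  set M : Submodule ℂ (EllTwo Γ H →L[ℂ] EllTwo Γ H) :=
    Submodule.span ℂ {T | ∃ b ∈ (⊤ : NonUnitalStarSubalgebra ℂ A), ∃ s : Γ,
        T = sigma α π b * leftReg Γ H s} with hM
  have mem (b : A) (s : Γ) : sigma α π b * leftReg Γ H s ∈ M :=
    Submodule.subset_span ⟨b, by trivial, s, rfl⟩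
  apply Set.Subset.antisymm
  · intro T hT
    induction hT using StarAlgebra.adjoin_induction with
    | mem x hx =>
      rcases hx with ⟨a, rfl⟩ | ⟨s, rfl⟩
      · simpa using mem a 1
      · simpa using mem 1 s
    | algebraMap c =>
      rw [Algebra.algebraMap_eq_smul_one]
      exact M.smul_mem c (by simpa using mem 1 1)
    | add x y _ _ hx hy => exact M.add_mem hx hy
    | mul x y _ _ hx hy =>
      have h : M * M ≤ M := by
        rw [hM, Submodule.span_mul_span, Submodule.span_le]
        rintro _ ⟨_, ⟨a, -, s, rfl⟩, _, ⟨b, -, u, rfl⟩, rfl⟩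
        have : sigma α π a * leftReg Γ H s * (sigma α π b * leftReg Γ H u) =
            sigma α π (a * α s b) * leftReg Γ H (s * u) := by
          rw [mul_assoc, ← mul_assoc (leftReg Γ H s), leftReg_mul_sigma, map_mul, map_mul]
          simp only [mul_assoc]
        simp only [this]
        exact mem _ _
      exact h (Submodule.mul_mem_mul hx hy)
    | star x _ hx =>
      refine Submodule.span_induction (p := fun x _ => star x ∈ M) ?_ ?_ ?_ ?_ hx
      · rintro _ ⟨a, -, s, rfl⟩
        rw [star_mul, star_leftReg, ← map_star, leftReg_mul_sigma]
        exact mem _ _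
      · simp
      · intro x y _ _ hx hy
        rw [star_add]
        exact M.add_mem hx hy
      · intro c x _ hx
        rw [star_smul]
        exact M.smul_mem _ hx
  · intro T hT
    refine Submodule.span_induction (p := fun x _ => x ∈ StarAlgebra.adjoin ℂ
      (Set.range (sigma α π) ∪ Set.range (leftReg Γ H))) ?_ ?_ ?_ ?_ hT
    · rintro _ ⟨a, -, s, rfl⟩
      exact mul_mem (StarAlgebra.subset_adjoin ℂ _ (Or.inl ⟨a, rfl⟩))
        (StarAlgebra.subset_adjoin ℂ _ (Or.inr ⟨s, rfl⟩))
    · exact zero_mem _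
    · intro x y _ _ hx hy
      exact add_mem hx hy
    · intro c x _ hx
      exact SMulMemClass.smul_mem c hx

/-- For `S = A` the two descriptions of the reduced crossed product agree. -/
theorem subCrossedProduct_top :
    (subCrossedProduct α π ⊤ : Set (EllTwo Γ H →L[ℂ] EllTwo Γ H)) =
      reducedCrossedProduct α π := by
  rw [reducedCrossedProduct, StarSubalgebra.topologicalClosure_coe, adjoin_eq_span]
  rfl

/-- Compression of an operator on `ℓ²(Γ, H)` to the coordinate of the neutral element. -/
def compression : (EllTwo Γ H →L[ℂ] EllTwo Γ H) →L[ℂ] (H →L[ℂ] H) := by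
  classical
  exact (ContinuousLinearMap.compL ℂ H (EllTwo Γ H) H
      (lp.evalCLM ℂ (fun _ : Γ => H) 2 (1 : Γ))).comp
    ((ContinuousLinearMap.compL ℂ H (EllTwo Γ H) (EllTwo Γ H)).flip
      (lp.singleContinuousLinearMap ℂ (fun _ : Γ => H) 2 (1 : Γ)))

open Classical in
theorem compression_sigma_mul_leftReg (a : A) (s : Γ) :
    compression (sigma α π a * leftReg Γ H s) = if s = 1 then π a else 0 := by
  ext v
  have h : compression (sigma α π a * leftReg Γ H s) v =
      π (α (1 : Γ)⁻¹ a) (lp.single (E := fun _ : Γ => H) 2 (1 : Γ) v (s⁻¹ * 1)) := rfl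
  rw [h, lp.single_apply]
  by_cases hs : s = 1
  · subst hs; simp
  · simp [hs]

variable {π} in
/-- A faithful `*`-representation, as a linear isometry. -/
def repIsometry (hπ : Function.Injective π) : A →ₗᵢ[ℂ] (H →L[ℂ] H) where
  toLinearMap := π.toAlgHom.toLinearMap
  norm_map' a := NonUnitalStarAlgHom.norm_map π hπ a

variable {π} in
theorem compression_mem_range (hπ : Function.Injective π) (T : reducedCrossedProduct α π) :
    compression (T : EllTwo Γ H →L[ℂ] EllTwo Γ H) ∈
      LinearMap.range (repIsometry hπ).toLinearMap := by
  classical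
  have hcl : IsClosed (LinearMap.range (repIsometry hπ).toLinearMap : Set (H →L[ℂ] H)) := by
    rw [LinearMap.coe_range]
    exact (repIsometry hπ).isometry.isClosedEmbedding.isClosed_range
  have hT : (T : EllTwo Γ H →L[ℂ] EllTwo Γ H) ∈ subCrossedProduct α π ⊤ := by
    rw [← SetLike.mem_coe, subCrossedProduct_top]
    exact T.2
  have hle : subCrossedProduct α π ⊤ ≤ (LinearMap.range (repIsometry hπ).toLinearMap).comap
      (compression (Γ := Γ) (H := H)).toLinearMap := by
    refine Submodule.topologicalClosure_minimal _ ?_ (hcl.preimage compression.continuous)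
    rw [Submodule.span_le]
    rintro _ ⟨a, -, s, rfl⟩
    change compression (sigma α π a * leftReg Γ H s) ∈ LinearMap.range (repIsometry hπ).toLinearMap
    rw [compression_sigma_mul_leftReg]
    split_ifs
    · exact ⟨a, rfl⟩
    · exact zero_mem _
  exact hle hT

variable {π} in
/-- The canonical conditional expectation `𝔼 : A ⋊_r Γ → A`, the continuous linear map with
`𝔼(σ(a) λ_s) = a` for `s = e` and `𝔼(σ(a) λ_s) = 0` for `s ≠ e`. (The copy `σ(A)` of `A` in the
crossed product is identified with `A`.) -/
def canonicalExpectation (hπ : Function.Injective π) : reducedCrossedProduct α π →L[ℂ] A :=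
  ((repIsometry hπ).equivRange.symm.toContinuousLinearEquiv :
      LinearMap.range (repIsometry hπ).toLinearMap →L[ℂ] A).comp
    ((compression.comp (reducedCrossedProduct α π).toSubalgebra.toSubmodule.subtypeL).codRestrict
      (LinearMap.range (repIsometry hπ).toLinearMap) (compression_mem_range α hπ))

variable {π} in
open Classical in
/-- The defining formula of the canonical conditional expectation. -/
theorem canonicalExpectation_sigma_mul_leftReg (hπ : Function.Injective π) (a : A) (s : Γ)
    (h : sigma α π a * leftReg Γ H s ∈ reducedCrossedProduct α π) :
    canonicalExpectation α hπ ⟨sigma α π a * leftReg Γ H s, h⟩ = if s = 1 then a else 0 := by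
  apply (repIsometry hπ).injective
  have h1 : repIsometry hπ (canonicalExpectation α hπ ⟨sigma α π a * leftReg Γ H s, h⟩) =
      compression (sigma α π a * leftReg Γ H s) :=
    congrArg Subtype.val ((repIsometry hπ).equivRange.apply_symm_apply
      ⟨compression (sigma α π a * leftReg Γ H s), compression_mem_range α hπ ⟨_, h⟩⟩)
  rw [h1, compression_sigma_mul_leftReg]
  split_ifs
  · rfl
  · simp

/-- The operator space `A_I = span {η x η' : η, η' ∈ I, x ∈ A ⋊_r Γ}` of an ideal `I` of
`C⋆_r(Γ)`. -/
def idealSpan (I : Ideal (reducedGroupCStar Γ H)) :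
    Submodule ℂ (EllTwo Γ H →L[ℂ] EllTwo Γ H) :=
  Submodule.span ℂ {T | ∃ η ∈ I, ∃ x ∈ reducedCrossedProduct α π, ∃ η' ∈ I,
    T = (η : EllTwo Γ H →L[ℂ] EllTwo Γ H) * x * (η' : EllTwo Γ H →L[ℂ] EllTwo Γ H)}

/-- The subspace `C⋆_r(Γ) + closure A_I` of `B(ℓ²(Γ, H))`. -/
def idealAlgebra (I : Ideal (reducedGroupCStar Γ H)) :
    Submodule ℂ (EllTwo Γ H →L[ℂ] EllTwo Γ H) :=
  (reducedGroupCStar Γ H).toSubalgebra.toSubmodule ⊔ (idealSpan α π I).topologicalClosure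

end CrossedProduct

end

/-! Two maps carry the argument. The invariant state `φ` gives a bounded `C⋆_r(Γ)`-bimodule
projection `Φ` of `A ⋊_r Γ` onto `C⋆_r(Γ)` with `Φ(σ(a) λ_s) = φ(a) λ_s`; the canonical expectation
`𝔼` goes the other way, onto `A`.

By the bimodule property `Φ` sends the closure of `A_I` into `I`, and approximate units put `I`
inside that closure. Hence `x ∈ B` if and only if `x - Φ(x)` lies in the closure of `A_I`, which is
a closed condition. If `σ(a) ∈ B`, then `b = a - φ(a)1` satisfies `σ(b) ∈ closure A_I`, so
`Φ(σ(b⋆b)) = φ(b⋆b)1` lies in the proper ideal `I`; thus `φ(b⋆b) = 0`, and faithfulness gives `b =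
0`. This is `B ∩ A = ℂ1`.

Density of `𝔼(A_I)` uses the i.c.c. property. For `y = η⋆η` with `0 ≠ η ∈ I`, the trace `τ(y)` is
nonzero, and `λ_h y λ_h⁻¹` stays in `I`. Choosing `h` that conjugates the finite supports of
approximants away from each other kills all cross terms, so `𝔼(y σ(a) λ_h y λ_h⁻¹)` tends to `τ(y)²
a`.

Since `𝔼` maps `C⋆_r(Γ)` into the scalars and `A ≠ ℂ`, both inclusions are strict. If `B = S ⋊_r Γ`,
then `S ⊆ B ∩ A = ℂ1`, which would force `B ⊆ C⋆_r(Γ)`.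

`Φ` is built by slicing: `φ` is extended to a functional `ψ` on `B(H)`, and `id ⊗ ψ` takes values in
the copy of `C⋆_r(Γ)` on `ℓ²(Γ)`, which is isometric to the one on `ℓ²(Γ, H)`. -/

open Filter Topology

set_option linter.unusedSectionVars false

noncomputable section

/-! ### Conjugation in i.c.c. groups -/

open scoped Pointwise in
/-- In an i.c.c. group, every finite set of nontrivial elements can be conjugated off itself. -/
theorem IsICC.exists_conj_notMem {Γ : Type*} [Group Γ] (hΓ : IsICC Γ) (F : Finset Γ)
    (hF : (1 : Γ) ∉ F) : ∃ h : Γ, ∀ f ∈ F, h * f * h⁻¹ ∉ F := by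
  classical
  by_contra! hcon
  choose f hfF hf using hcon
  let g : Γ × Γ → Γ := fun p => if hp : ∃ h : Γ, h * p.1 * h⁻¹ = p.2 then hp.choose else 1
  -- The elements conjugating `a` to `b` form a left coset of the centralizer of `a`. If no `h`
  -- works, finitely many such cosets cover `Γ`, so by B. H. Neumann's lemma some centralizer has
  -- finite index, making a nontrivial conjugacy class finite.
  have hcov : ⋃ p ∈ F ×ˢ F, g p • (Subgroup.centralizer {p.1} : Set Γ) = Set.univ := by
    refine Set.eq_univ_of_forall fun h => ?_
    have hex : ∃ k : Γ, k * f h * k⁻¹ = h * f h * h⁻¹ := ⟨h, rfl⟩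
    have hg : g (f h, h * f h * h⁻¹) * f h * (g (f h, h * f h * h⁻¹))⁻¹ = h * f h * h⁻¹ := by
      simp only [g, dif_pos hex]
      exact hex.choose_spec
    refine Set.mem_iUnion₂.2 ⟨(f h, h * f h * h⁻¹), Finset.mk_mem_product (hfF h) (hf h), ?_⟩
    rw [Set.mem_smul_set_iff_inv_smul_mem, SetLike.mem_coe, Subgroup.mem_centralizer_singleton_iff]
    generalize g (f h, h * f h * h⁻¹) = k at hg
    rw [smul_eq_mul]
    calc k⁻¹ * h * f h = k⁻¹ * (h * f h * h⁻¹) * h := by group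
      _ = k⁻¹ * (k * f h * k⁻¹) * h := by rw [hg]
      _ = f h * (k⁻¹ * h) := by group
  obtain ⟨⟨a, b⟩, hab, hfin⟩ := Subgroup.exists_finiteIndex_of_leftCoset_cover hcov
  have ha : a ≠ 1 := by
    rintro rfl
    exact hF (Finset.mem_product.1 hab).1
  refine hΓ.2 a ha ?_
  have h1 : Finite (Γ ⧸ Subgroup.centralizer {a}) := Subgroup.finite_quotient_of_finiteIndex
  let c : Γ ⧸ Subgroup.centralizer {a} → Γ := Quotient.lift (fun k : Γ => k * a * k⁻¹) (by
    intro k l hkl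
    have := QuotientGroup.leftRel_apply.1 hkl
    rw [Subgroup.mem_centralizer_singleton_iff] at this
    calc k * a * k⁻¹ = k * (a * (k⁻¹ * l)) * l⁻¹ := by group
      _ = k * (k⁻¹ * l * a) * l⁻¹ := by rw [this]
      _ = l * a * l⁻¹ := by group)
  refine (Set.finite_range c).subset ?_
  rintro x hx
  obtain ⟨k, rfl⟩ := isConj_iff.1 (show IsConj a x from hx)
  exact ⟨QuotientGroup.mk k, rfl⟩

/-! ### Approximate units in closed ideals -/

section ClosedIdeal

variable {C : Type*} [CStarAlgebra C]

/-- In a two-sided ideal `I` of a C⋆-algebra, elements of `I` are approximate right units for the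
adjoint of any element of `I`. -/
theorem Ideal.exists_norm_star_sub_star_mul_le (I : Ideal C) [I.IsTwoSided] {x : C} (hx : x ∈ I)
    {δ : ℝ} (hδ : 0 < δ) : ∃ u ∈ I, ‖star x - star x * u‖ ^ 2 ≤ δ := by
  set y := x * star x with hy
  have hyI : y ∈ I := I.mul_mem_right _ hx
  have hysa : IsSelfAdjoint y := .mul_star_self x
  have hpos (t : ℝ) : t ^ 2 + δ ^ 2 ≠ 0 := by positivity
  set w := cfc (fun t : ℝ => (t ^ 2 + δ ^ 2)⁻¹) y with hw
  set v := cfc (fun t : ℝ => δ ^ 2 * (t ^ 2 + δ ^ 2)⁻¹) y with hv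
  have hcont : ContinuousOn (fun t : ℝ => (t ^ 2 + δ ^ 2)⁻¹) (spectrum ℝ y) :=
    Continuous.continuousOn (by fun_prop (disch := exact hpos _))
  have hcont' : ContinuousOn (fun t : ℝ => δ ^ 2 * (t ^ 2 + δ ^ 2)⁻¹) (spectrum ℝ y) :=
    continuousOn_const.mul hcont
  have hcont2 : ContinuousOn (fun t : ℝ => (t ^ 2 + δ ^ 2)⁻¹ * t) (spectrum ℝ y) :=
    hcont.mul continuousOn_id
  have hcont2' : ContinuousOn (fun t : ℝ => δ ^ 2 * (t ^ 2 + δ ^ 2)⁻¹ * t) (spectrum ℝ y) :=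
    hcont'.mul continuousOn_id
  have hcont3 : ContinuousOn (fun t : ℝ => (t ^ 2 + δ ^ 2)⁻¹ * t * t) (spectrum ℝ y) :=
    hcont2.mul continuousOn_id
  -- The approximate unit is `u = y² (y² + δ²)⁻¹`, so `1 - u = v` and `‖x⋆(1 - u)‖² = ‖v y v‖`. The
  -- function involved is bounded by `δ` on all of `ℝ`, since `δ |t| ≤ t² + δ²`.
  have hv1 : 1 - w * y * y = v := by
    have h1 : (1 : C) = cfc (fun _ : ℝ => (1 : ℝ)) y := (cfc_const_one ℝ y).symm
    have h2 : y = cfc (fun t : ℝ => t) y := (cfc_id' ℝ y).symm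
    have h3 : w * y * y = cfc (fun t : ℝ => (t ^ 2 + δ ^ 2)⁻¹ * t * t) y := by
      rw [cfc_mul _ _ y hcont2, cfc_mul _ _ y hcont, ← h2]
    rw [h3, h1, ← cfc_sub _ _ y continuousOn_const hcont3]
    refine cfc_congr fun t _ => ?_
    have := hpos t
    field_simp
    ring
  have hvsa : star v = v := (cfc_predicate _ y : IsSelfAdjoint v).star_eq
  refine ⟨w * y * y, I.mul_mem_left _ hyI, ?_⟩
  have h1 : star x - star x * (w * y * y) = star x * v := by rw [← hv1, mul_sub, mul_one]
  have h2 : star (star x * v) * (star x * v) = v * y * v := by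
    rw [star_mul, star_star, hvsa, hy]
    simp only [mul_assoc]
  have h3 : v * y * v = cfc (fun t : ℝ => δ ^ 2 * (t ^ 2 + δ ^ 2)⁻¹ * t *
      (δ ^ 2 * (t ^ 2 + δ ^ 2)⁻¹)) y := by
    rw [cfc_mul _ _ y hcont2' hcont', cfc_mul _ _ y hcont', cfc_id' ℝ y]
  rw [h1, sq, ← CStarRing.norm_star_mul_self, h2, h3]
  refine norm_cfc_le hδ.le fun t _ => ?_
  have hp : 0 < t ^ 2 + δ ^ 2 := by positivity
  have e1 : δ ^ 2 * (t ^ 2 + δ ^ 2)⁻¹ ≤ 1 := by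
    rw [← div_eq_mul_inv, div_le_one hp]
    nlinarith [sq_nonneg t]
  have e2 : δ ^ 2 * (t ^ 2 + δ ^ 2)⁻¹ * |t| ≤ δ := by
    rw [← div_eq_mul_inv, div_mul_eq_mul_div, div_le_iff₀ hp]
    have : δ * |t| ≤ t ^ 2 + δ ^ 2 := by
      nlinarith [sq_nonneg (δ - |t|), sq_abs t, sq_nonneg δ, sq_nonneg t]
    nlinarith
  have e0 : 0 ≤ δ ^ 2 * (t ^ 2 + δ ^ 2)⁻¹ := by positivity
  rw [norm_mul, norm_mul, Real.norm_of_nonneg e0, Real.norm_eq_abs]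
  exact (mul_le_of_le_one_right (by positivity) e1).trans e2

/-- Closed two-sided ideals of a C⋆-algebra are closed under the adjoint. -/
theorem Ideal.star_mem_of_isClosed (I : Ideal C) [I.IsTwoSided] (hI : IsClosed (I : Set C))
    {x : C} (hx : x ∈ I) : star x ∈ I := by
  rw [← SetLike.mem_coe, ← hI.closure_eq, Metric.mem_closure_iff]
  intro ε hε
  obtain ⟨u, hu, h⟩ := I.exists_norm_star_sub_star_mul_le hx (δ := (ε / 2) ^ 2) (by positivity)
  refine ⟨star x * u, I.mul_mem_left _ hu, ?_⟩
  rw [dist_eq_norm]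
  have := abs_le_of_sq_le_sq h (by positivity)
  rw [abs_of_nonneg (norm_nonneg _)] at this
  linarith

/-- Each element `x` of a closed two-sided ideal `I` of a C⋆-algebra is a limit of products `x * u`
with `u` in `I`. -/
theorem Ideal.exists_norm_sub_mul_lt (I : Ideal C) [I.IsTwoSided] (hI : IsClosed (I : Set C))
    {x : C} (hx : x ∈ I) {ε : ℝ} (hε : 0 < ε) : ∃ u ∈ I, ‖x - x * u‖ < ε := by
  obtain ⟨u, hu, h⟩ := I.exists_norm_star_sub_star_mul_le (I.star_mem_of_isClosed hI hx)
    (δ := (ε / 2) ^ 2) (by positivity)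
  refine ⟨u, hu, ?_⟩
  rw [star_star] at h
  have := abs_le_of_sq_le_sq h (by positivity)
  rw [abs_of_nonneg (norm_nonneg _)] at this
  linarith

end ClosedIdeal

/-! ### The reduced group C⋆-algebra and its trace -/

section Regular

variable {Γ : Type*} [Group Γ]
variable {H : Type*} [NormedAddCommGroup H] [InnerProductSpace ℂ H] [CompleteSpace H]

theorem norm_leftReg_le (s : Γ) : ‖leftReg Γ H s‖ ≤ 1 :=
  show ‖translationOp Γ H s‖ ≤ 1 from by
    unfold translationOp
    exact LinearMap.mkContinuous_norm_le _ zero_le_one _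

variable (Γ H) in
theorem adjoin_range_leftReg_eq_span :
    ((StarAlgebra.adjoin ℂ (Set.range (leftReg Γ H)) :
        StarSubalgebra ℂ (EllTwo Γ H →L[ℂ] EllTwo Γ H)) : Set (EllTwo Γ H →L[ℂ] EllTwo Γ H)) =
      (Submodule.span ℂ (Set.range (leftReg Γ H)) :
        Submodule ℂ (EllTwo Γ H →L[ℂ] EllTwo Γ H)) := by
  set M : Submodule ℂ (EllTwo Γ H →L[ℂ] EllTwo Γ H) := Submodule.span ℂ (Set.range (leftReg Γ H))
    with hM
  have mem (s : Γ) : leftReg Γ H s ∈ M := Submodule.subset_span ⟨s, rfl⟩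
  apply Set.Subset.antisymm
  · intro T hT
    induction hT using StarAlgebra.adjoin_induction with
    | mem x hx => exact Submodule.subset_span hx
    | algebraMap c =>
      rw [Algebra.algebraMap_eq_smul_one]
      exact M.smul_mem c (by simpa using mem 1)
    | add x y _ _ hx hy => exact M.add_mem hx hy
    | mul x y _ _ hx hy =>
      have h : M * M ≤ M := by
        rw [hM, Submodule.span_mul_span, Submodule.span_le]
        rintro _ ⟨_, ⟨s, rfl⟩, _, ⟨u, rfl⟩, rfl⟩
        change leftReg Γ H s * leftReg Γ H u ∈ M
        rw [← map_mul]
        exact mem _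
      exact h (Submodule.mul_mem_mul hx hy)
    | star x _ hx =>
      refine Submodule.span_induction (p := fun x _ => star x ∈ M) ?_ ?_ ?_ ?_ hx
      · rintro _ ⟨s, rfl⟩
        rw [star_leftReg]
        exact mem _
      · simp
      · intro x y _ _ hx hy
        rw [star_add]
        exact M.add_mem hx hy
      · intro c x _ hx
        rw [star_smul]
        exact M.smul_mem _ hx
  · have h : M ≤ (StarAlgebra.adjoin ℂ (Set.range (leftReg Γ H)) :
        StarSubalgebra ℂ (EllTwo Γ H →L[ℂ] EllTwo Γ H)).toSubalgebra.toSubmodule :=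
      Submodule.span_le.2 (StarAlgebra.subset_adjoin ℂ _)
    exact h

variable (Γ H) in
theorem isClosed_reducedGroupCStar :
    IsClosed (reducedGroupCStar Γ H : Set (EllTwo Γ H →L[ℂ] EllTwo Γ H)) :=
  StarSubalgebra.isClosed_topologicalClosure _

theorem leftReg_mem_reducedGroupCStar (s : Γ) : leftReg Γ H s ∈ reducedGroupCStar Γ H :=
  StarSubalgebra.le_topologicalClosure _ (StarAlgebra.subset_adjoin ℂ _ ⟨s, rfl⟩)

variable (Γ H) in
theorem coe_reducedGroupCStar :
    (reducedGroupCStar Γ H : Set (EllTwo Γ H →L[ℂ] EllTwo Γ H)) =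
      (Submodule.span ℂ (Set.range (leftReg Γ H))).topologicalClosure := by
  rw [reducedGroupCStar, StarSubalgebra.topologicalClosure_coe, adjoin_range_leftReg_eq_span,
    Submodule.topologicalClosure_coe]

/-- A closed subspace containing all translations contains the reduced group C⋆-algebra. -/
theorem mem_of_mem_reducedGroupCStar {T : EllTwo Γ H →L[ℂ] EllTwo Γ H}
    (hT : T ∈ reducedGroupCStar Γ H) (p : Submodule ℂ (EllTwo Γ H →L[ℂ] EllTwo Γ H))
    (hp : IsClosed (p : Set (EllTwo Γ H →L[ℂ] EllTwo Γ H))) (h : ∀ s, leftReg Γ H s ∈ p) :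
    T ∈ p := by
  rw [← SetLike.mem_coe, coe_reducedGroupCStar] at hT
  refine Submodule.topologicalClosure_minimal _ (Submodule.span_le.2 ?_) hp hT
  rintro _ ⟨s, rfl⟩
  exact h s

open Classical in
theorem compression_apply (T : EllTwo Γ H →L[ℂ] EllTwo Γ H) (v : H) :
    compression T v = T (lp.single (E := fun _ : Γ => H) 2 (1 : Γ) v) 1 := rfl

open Classical in
theorem compression_leftReg (s : Γ) :
    compression (leftReg Γ H s) = if s = 1 then 1 else 0 := by
  ext v
  rw [compression_apply, leftReg_apply, lp.single_apply]
  by_cases hs : s = 1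
  · subst hs; simp
  · simp [hs]

/-- The compression of an element of the reduced group C⋆-algebra is a scalar. -/
theorem exists_compression_eq_smul_one {T : EllTwo Γ H →L[ℂ] EllTwo Γ H}
    (hT : T ∈ reducedGroupCStar Γ H) : ∃ z : ℂ, compression T = z • (1 : H →L[ℂ] H) := by
  classical
  have h := mem_of_mem_reducedGroupCStar hT
    ((ℂ ∙ (1 : H →L[ℂ] H)).comap (compression (Γ := Γ) (H := H)).toLinearMap)
    ((Submodule.closed_of_finiteDimensional (ℂ ∙ (1 : H →L[ℂ] H))).preimage compression.continuous) fun s => by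
      change compression (leftReg Γ H s) ∈ ℂ ∙ (1 : H →L[ℂ] H)
      rw [compression_leftReg]
      split_ifs
      · exact Submodule.mem_span_singleton_self _
      · exact zero_mem _
  obtain ⟨z, hz⟩ := Submodule.mem_span_singleton.1 h
  exact ⟨z, hz.symm⟩

open Classical in
/-- Matrix coefficients of elements of the reduced group C⋆-algebra are invariant under right
translation. -/
theorem reducedGroupCStar_apply_single {T : EllTwo Γ H →L[ℂ] EllTwo Γ H}
    (hT : T ∈ reducedGroupCStar Γ H) (t s : Γ) (v : H) :
    T (lp.single (E := fun _ : Γ => H) 2 t v) s =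
      T (lp.single (E := fun _ : Γ => H) 2 (1 : Γ) v) (s * t⁻¹) := by
  -- `F t s` reads off the matrix entry in row `s`, column `t`. For `λ_g` it is nonzero only when `g
  -- = s t⁻¹`.
  let F (t s : Γ) : (EllTwo Γ H →L[ℂ] EllTwo Γ H) →L[ℂ] H :=
    (lp.evalCLM ℂ (fun _ : Γ => H) 2 s).comp
      (ContinuousLinearMap.apply ℂ (EllTwo Γ H) (lp.single (E := fun _ : Γ => H) 2 t v))
  have h := mem_of_mem_reducedGroupCStar hT (LinearMap.ker (F t s - F 1 (s * t⁻¹)).toLinearMap)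
    (F t s - F 1 (s * t⁻¹)).isClosed_ker fun g => by
      rw [LinearMap.mem_ker]
      change leftReg Γ H g (lp.single (E := fun _ : Γ => H) 2 t v) s -
        leftReg Γ H g (lp.single (E := fun _ : Γ => H) 2 (1 : Γ) v) (s * t⁻¹) = 0
      rw [leftReg_apply, leftReg_apply, lp.single_apply, lp.single_apply, sub_eq_zero]
      have : g⁻¹ * s = t ↔ g⁻¹ * (s * t⁻¹) = 1 := by
        rw [← mul_assoc, mul_inv_eq_one]
      by_cases hh : g⁻¹ * s = t
      · rw [this.1 hh, hh]; simp
      · rw [Pi.single_eq_of_ne hh, Pi.single_eq_of_ne (this.not.1 hh)]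
  exact sub_eq_zero.1 h

open Classical in
theorem ext_single {E : Type*} [NormedAddCommGroup E] [NormedSpace ℂ E]
    {S T : EllTwo Γ H →L[ℂ] E}
    (h : ∀ t v, S (lp.single (E := fun _ : Γ => H) 2 t v) =
      T (lp.single (E := fun _ : Γ => H) 2 t v)) : S = T := by
  ext ξ
  have hs := lp.hasSum_single (E := fun _ : Γ => H) (p := 2) (by simp) ξ
  refine (hs.mapL S).unique ?_
  simp_rw [h]
  exact hs.mapL T

open Classical in
/-- An element of the reduced group C⋆-algebra is determined by its first column. -/
theorem eq_zero_of_apply_single_one {T : EllTwo Γ H →L[ℂ] EllTwo Γ H}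
    (hT : T ∈ reducedGroupCStar Γ H)
    (h : ∀ v, T (lp.single (E := fun _ : Γ => H) 2 (1 : Γ) v) = 0) : T = 0 := by
  refine ext_single fun t v => ?_
  ext s
  rw [reducedGroupCStar_apply_single hT, h]
  rfl

/-- The canonical trace on the reduced group C⋆-algebra is faithful. -/
theorem eq_zero_of_compression_star_mul_self {T : EllTwo Γ H →L[ℂ] EllTwo Γ H}
    (hT : T ∈ reducedGroupCStar Γ H) (h : compression (star T * T) = 0) : T = 0 := by
  classical
  refine eq_zero_of_apply_single_one hT fun v => ?_
  -- The squared norm of `T (δ_1 ⊗ v)` is `⟨v, compression (T⋆T) v⟩`.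
  rw [← inner_self_eq_zero (𝕜 := ℂ), ← ContinuousLinearMap.adjoint_inner_right,
    lp.inner_single_left]
  have := congrArg (fun S : H →L[ℂ] H => S v) h
  rw [compression_apply] at this
  rw [← ContinuousLinearMap.star_eq_adjoint]
  change inner ℂ v ((star T * T) (lp.single (E := fun _ : Γ => H) 2 (1 : Γ) v) 1) = 0
  rw [this]
  simp

end Regular

/-! ### Asymptotic decoupling by conjugation -/

section CrossedProduct

variable {Γ : Type*} [Group Γ] {A : Type*} [CStarAlgebra A] (α : Γ →* (A ≃⋆ₐ[ℂ] A))
variable {H : Type*} [NormedAddCommGroup H] [InnerProductSpace ℂ H] [CompleteSpace H]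
variable (π : A →⋆ₐ[ℂ] (H →L[ℂ] H))

theorem isClosed_reducedCrossedProduct :
    IsClosed (reducedCrossedProduct α π : Set (EllTwo Γ H →L[ℂ] EllTwo Γ H)) :=
  StarSubalgebra.isClosed_topologicalClosure _

theorem sigma_mem_reducedCrossedProduct (a : A) : sigma α π a ∈ reducedCrossedProduct α π :=
  StarSubalgebra.le_topologicalClosure _ (StarAlgebra.subset_adjoin ℂ _ (Or.inl ⟨a, rfl⟩))

theorem reducedGroupCStar_le_reducedCrossedProduct :
    reducedGroupCStar Γ H ≤ reducedCrossedProduct α π :=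
  StarSubalgebra.topologicalClosure_mono (StarAlgebra.adjoin_mono Set.subset_union_right)

variable {α π} in
/-- A closed subspace containing all `σ(a) λ_s` contains the reduced crossed product. -/
theorem mem_of_mem_reducedCrossedProduct {T : EllTwo Γ H →L[ℂ] EllTwo Γ H}
    (hT : T ∈ reducedCrossedProduct α π) (p : Submodule ℂ (EllTwo Γ H →L[ℂ] EllTwo Γ H))
    (hp : IsClosed (p : Set (EllTwo Γ H →L[ℂ] EllTwo Γ H)))
    (h : ∀ a s, sigma α π a * leftReg Γ H s ∈ p) : T ∈ p := by
  rw [← SetLike.mem_coe, ← subCrossedProduct_top] at hT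
  refine Submodule.topologicalClosure_minimal _ (Submodule.span_le.2 ?_) hp hT
  rintro _ ⟨a, -, s, rfl⟩
  exact h a s

/-- Conjugating one factor far away in an i.c.c. group decouples the compression of a product, for
finite combinations of translations. -/
theorem exists_compression_conj_eq (hΓ : IsICC Γ) (a : A) {p q : EllTwo Γ H →L[ℂ] EllTwo Γ H}
    (hp : p ∈ Submodule.span ℂ (Set.range (leftReg Γ H)))
    (hq : q ∈ Submodule.span ℂ (Set.range (leftReg Γ H))) :
    ∃ h : Γ, compression (p * sigma α π a * (leftReg Γ H h * q * leftReg Γ H h⁻¹)) =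
      compression p * π a * compression q := by
  classical
  obtain ⟨c, rfl⟩ := Finsupp.mem_span_range_iff_exists_finsupp.1 hp
  obtain ⟨d, rfl⟩ := Finsupp.mem_span_range_iff_exists_finsupp.1 hq
  -- The term for `s`, `t` survives compression only if `s = h t⁻¹ h⁻¹`. Putting the support of `p`
  -- and the inverses of the support of `q` into one finite set excludes this unless `s = t = 1`.
  obtain ⟨h, hh⟩ := hΓ.exists_conj_notMem
    ((c.support ∪ d.support.image (·⁻¹)).erase 1) (Finset.notMem_erase _ _)
  refine ⟨h, ?_⟩
  have key (s t : Γ) (hs : s ∈ c.support) (ht : t ∈ d.support) :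
      compression (leftReg Γ H s * sigma α π a * (leftReg Γ H h * leftReg Γ H t *
        leftReg Γ H h⁻¹)) =
      compression (leftReg Γ H s) * π a * compression (leftReg Γ H t) := by
    rw [leftReg_mul_sigma, mul_assoc, ← map_mul, ← map_mul, ← map_mul,
      compression_sigma_mul_leftReg, compression_leftReg, compression_leftReg]
    by_cases h1 : t = 1
    · subst h1
      by_cases h2 : s = 1
      · subst h2; simp
      · simp [h2]
    · rw [if_neg h1, mul_zero, if_neg]
      intro h3
      have h4 : h * t⁻¹ * h⁻¹ = s := by
        have := eq_inv_of_mul_eq_one_left h3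
        rw [this]; group
      refine hh t⁻¹ ?_ ?_
      · exact Finset.mem_erase.2 ⟨inv_ne_one.2 h1,
          Finset.mem_union_right _ (Finset.mem_image_of_mem _ ht)⟩
      · refine Finset.mem_erase.2 ⟨?_, ?_⟩
        · simpa using h1
        · rw [h4]; exact Finset.mem_union_left _ hs
  simp only [Finsupp.sum, Finset.sum_mul, Finset.mul_sum, map_sum, smul_mul_assoc, mul_smul_comm,
    map_smul]
  refine Finset.sum_congr rfl fun t ht => congrArg _ (Finset.sum_congr rfl fun s hs => ?_)
  rw [key s t hs ht]

/-- Conjugating one factor far away in an i.c.c. group asymptotically decouples the compression of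
a product. -/
theorem exists_tendsto_compression_conj (hΓ : IsICC Γ) (a : A)
    {x y : EllTwo Γ H →L[ℂ] EllTwo Γ H} (hx : x ∈ reducedGroupCStar Γ H)
    (hy : y ∈ reducedGroupCStar Γ H) :
    ∃ h : ℕ → Γ, Tendsto (fun n => compression (x * sigma α π a *
      (leftReg Γ H (h n) * y * leftReg Γ H (h n)⁻¹))) atTop
      (𝓝 (compression x * π a * compression y)) := by
  rw [← SetLike.mem_coe, coe_reducedGroupCStar] at hx hy
  obtain ⟨p, hp, hpx⟩ := mem_closure_iff_seq_limit.1 hx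
  obtain ⟨q, hq, hqy⟩ := mem_closure_iff_seq_limit.1 hy
  -- `h n` is adapted to the finitely supported approximants. Conjugation by `λ` is contractive
  -- uniformly in `h`, so replacing them by `x` and `y` costs an error tending to `0`.
  choose h hh using fun n => exists_compression_conj_eq α π hΓ a (hp n) (hq n)
  refine ⟨h, ?_⟩
  have h1 : Tendsto (fun n => compression (p n) * π a * compression (q n)) atTop
      (𝓝 (compression x * π a * compression y)) :=
    (((compression.continuous.tendsto x).comp hpx).mul_const _).mul
      ((compression.continuous.tendsto y).comp hqy)
  have hb (n : ℕ) (z : EllTwo Γ H →L[ℂ] EllTwo Γ H) :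
      ‖leftReg Γ H (h n) * z * leftReg Γ H (h n)⁻¹‖ ≤ ‖z‖ := by
    calc _ ≤ ‖leftReg Γ H (h n)‖ * ‖z‖ * ‖leftReg Γ H (h n)⁻¹‖ :=
          (norm_mul_le _ _).trans (by gcongr; exact norm_mul_le _ _)
      _ ≤ 1 * ‖z‖ * 1 := by gcongr <;> exact norm_leftReg_le _
      _ = ‖z‖ := by ring
  have h2 : Tendsto (fun n => x * sigma α π a * (leftReg Γ H (h n) * y * leftReg Γ H (h n)⁻¹) -
      p n * sigma α π a * (leftReg Γ H (h n) * q n * leftReg Γ H (h n)⁻¹)) atTop (𝓝 0) := by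
    refine squeeze_zero_norm (a := fun n => ‖x - p n‖ * ‖sigma α π a‖ * ‖y‖ +
      ‖p n‖ * ‖sigma α π a‖ * ‖y - q n‖) (fun n => ?_) ?_
    · have e : x * sigma α π a * (leftReg Γ H (h n) * y * leftReg Γ H (h n)⁻¹) -
          p n * sigma α π a * (leftReg Γ H (h n) * q n * leftReg Γ H (h n)⁻¹) =
          (x - p n) * sigma α π a * (leftReg Γ H (h n) * y * leftReg Γ H (h n)⁻¹) +
          p n * sigma α π a * (leftReg Γ H (h n) * (y - q n) * leftReg Γ H (h n)⁻¹) := by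
        noncomm_ring
      rw [e]
      have hm (u v w : EllTwo Γ H →L[ℂ] EllTwo Γ H) : ‖u * v * w‖ ≤ ‖u‖ * ‖v‖ * ‖w‖ :=
        (norm_mul_le _ _).trans (by gcongr; exact norm_mul_le _ _)
      refine (norm_add_le _ _).trans (add_le_add ?_ ?_)
      · exact (hm _ _ _).trans (by gcongr; exact hb _ _)
      · exact (hm _ _ _).trans (by gcongr; exact hb _ _)
    · have ex : Tendsto (fun n => ‖x - p n‖) atTop (𝓝 0) := by
        simpa using ((tendsto_const_nhds (x := x)).sub hpx).norm
      have ey : Tendsto (fun n => ‖y - q n‖) atTop (𝓝 0) := by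
        simpa using ((tendsto_const_nhds (x := y)).sub hqy).norm
      simpa using ((ex.mul_const ‖sigma α π a‖).mul_const ‖y‖).add
        ((hpx.norm.mul_const ‖sigma α π a‖).mul ey)
  have h3 := ((compression.continuous.tendsto 0).comp h2).add h1
  rw [map_zero, zero_add] at h3
  refine h3.congr fun n => ?_
  rw [← hh n, Function.comp_apply, map_sub, sub_add_cancel]

end CrossedProduct

/-! ### Slice maps from `B(ℓ²(Γ, H))` to `B(ℓ²(Γ))` -/

section Slice

variable {Γ : Type*} [Group Γ]
variable {H : Type*} [NormedAddCommGroup H] [InnerProductSpace ℂ H] [CompleteSpace H]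

theorem norm_smul_const_eq (c : EllTwo Γ ℂ) (v : H) (t : Γ) : ‖c t • v‖ = ‖(‖v‖ • c) t‖ := by
  rw [lp.coeFn_smul, Pi.smul_apply, norm_smul, norm_smul, norm_norm, mul_comm]

variable (Γ H) in
/-- The bounded bilinear map sending `c ∈ ℓ²(Γ)` and `v ∈ H` to `c ⊗ v ∈ ℓ²(Γ, H)`. -/
def elementaryTensor : EllTwo Γ ℂ →L[ℂ] H →L[ℂ] EllTwo Γ H :=
  LinearMap.mkContinuous₂
    (LinearMap.mk₂ ℂ (fun (c : EllTwo Γ ℂ) (v : H) => (⟨fun t => c t • v,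
        Memℓp.mono' (lp.memℓp (‖v‖ • c)) fun t => (norm_smul_const_eq c v t).le⟩ : EllTwo Γ H))
      (fun c c' v => by ext t; exact add_smul (c t) (c' t) v)
      (fun z c v => by ext t; exact mul_smul z (c t) v)
      (fun c v w => by ext t; exact smul_add (c t) v w)
      (fun z c v => by ext t; exact smul_comm (c t) z v))
    1 fun c v => by
      rw [one_mul, mul_comm, ← norm_norm v, ← norm_smul]
      exact lp.norm_mono (by simp) fun t => (norm_smul_const_eq c v t).le

theorem elementaryTensor_apply (c : EllTwo Γ ℂ) (v : H) (t : Γ) :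
    elementaryTensor Γ H c v t = c t • v := rfl

theorem norm_elementaryTensor_le (c : EllTwo Γ ℂ) : ‖elementaryTensor Γ H c‖ ≤ ‖c‖ := by
  refine ContinuousLinearMap.opNorm_le_bound _ (norm_nonneg c) fun v => ?_
  rw [mul_comm, ← norm_norm v, ← norm_smul]
  exact lp.norm_mono (by simp) fun t => (norm_smul_const_eq c v t).le

open Classical in
theorem elementaryTensor_single (t : Γ) (z : ℂ) (v : H) :
    elementaryTensor Γ H (lp.single (E := fun _ : Γ => ℂ) 2 t z) v =
      lp.single (E := fun _ : Γ => H) 2 t (z • v) := by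
  ext u
  rw [elementaryTensor_apply, lp.single_apply, lp.single_apply]
  by_cases h : u = t
  · subst h; simp
  · simp [h]

/-- The operator `V_d⋆ T V_c` on `H`, where `V_c v = c ⊗ v`. -/
def sandwich (T : EllTwo Γ H →L[ℂ] EllTwo Γ H) (d c : EllTwo Γ ℂ) : H →L[ℂ] H :=
  (ContinuousLinearMap.adjoint (elementaryTensor Γ H d)).comp (T.comp (elementaryTensor Γ H c))

theorem inner_sandwich (T : EllTwo Γ H →L[ℂ] EllTwo Γ H) (d c : EllTwo Γ ℂ) (v w : H) :
    inner ℂ v (sandwich T d c w) =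
      inner ℂ (elementaryTensor Γ H d v) (T (elementaryTensor Γ H c w)) := by
  rw [sandwich, ContinuousLinearMap.comp_apply, ContinuousLinearMap.comp_apply,
    ContinuousLinearMap.adjoint_inner_right]

theorem norm_sandwich_le (T : EllTwo Γ H →L[ℂ] EllTwo Γ H) (d c : EllTwo Γ ℂ) :
    ‖sandwich T d c‖ ≤ ‖T‖ * ‖d‖ * ‖c‖ := by
  calc ‖sandwich T d c‖ ≤ ‖ContinuousLinearMap.adjoint (elementaryTensor Γ H d)‖ *
        (‖T‖ * ‖elementaryTensor Γ H c‖) :=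
        (ContinuousLinearMap.opNorm_comp_le _ _).trans
          (by gcongr; exact ContinuousLinearMap.opNorm_comp_le _ _)
    _ ≤ ‖d‖ * (‖T‖ * ‖c‖) := by
        rw [LinearIsometryEquiv.norm_map]
        gcongr <;> exact norm_elementaryTensor_le _
    _ = _ := by ring

/-- The sesquilinear form `(d, c) ↦ ψ(V_d⋆ T V_c)` on `ℓ²(Γ)`. -/
def sliceForm (ψ : StrongDual ℂ (H →L[ℂ] H)) (T : EllTwo Γ H →L[ℂ] EllTwo Γ H) :
    EllTwo Γ ℂ →L⋆[ℂ] EllTwo Γ ℂ →L[ℂ] ℂ :=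
  LinearMap.mkContinuous₂
    (LinearMap.mk₂'ₛₗ (starRingEnd ℂ) (RingHom.id ℂ) (fun d c => ψ (sandwich T d c))
      (fun d d' c => by rw [← map_add]; congr 1; ext v; simp [sandwich])
      (fun z d c => by rw [smul_eq_mul, ← smul_eq_mul, ← map_smul]; congr 1; ext v; simp [sandwich, map_smulₛₗ])
      (fun d c c' => by rw [← map_add]; congr 1; ext v; simp [sandwich])
      (fun z d c => by rw [RingHom.id_apply, ← map_smul]; congr 1; ext v; simp [sandwich]))
    (‖ψ‖ * ‖T‖) fun d c => by
      refine (ψ.le_opNorm _).trans ?_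
      calc ‖ψ‖ * ‖sandwich T d c‖ ≤ ‖ψ‖ * (‖T‖ * ‖d‖ * ‖c‖) := by
            gcongr; exact norm_sandwich_le T d c
        _ = _ := by ring

theorem sliceForm_apply (ψ : StrongDual ℂ (H →L[ℂ] H)) (T : EllTwo Γ H →L[ℂ] EllTwo Γ H)
    (d c : EllTwo Γ ℂ) : sliceForm ψ T d c = ψ (sandwich T d c) := rfl

/-- The operator `(id ⊗ ψ)(T)` on `ℓ²(Γ)`. -/
def sliceOp (ψ : StrongDual ℂ (H →L[ℂ] H)) (T : EllTwo Γ H →L[ℂ] EllTwo Γ H) :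
    EllTwo Γ ℂ →L[ℂ] EllTwo Γ ℂ :=
  -- `continuousLinearMapOfBilin` places the operator in the conjugate-linear slot; the adjoint
  -- moves it to the other one.
  ContinuousLinearMap.adjoint
    (InnerProductSpace.continuousLinearMapOfBilin (sliceForm ψ T))

theorem inner_sliceOp (ψ : StrongDual ℂ (H →L[ℂ] H)) (T : EllTwo Γ H →L[ℂ] EllTwo Γ H)
    (d c : EllTwo Γ ℂ) : inner ℂ d (sliceOp ψ T c) = ψ (sandwich T d c) := by
  rw [sliceOp, ContinuousLinearMap.adjoint_inner_right,
    InnerProductSpace.continuousLinearMapOfBilin_apply, sliceForm_apply]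

theorem norm_sliceOp_le (ψ : StrongDual ℂ (H →L[ℂ] H)) (T : EllTwo Γ H →L[ℂ] EllTwo Γ H) :
    ‖sliceOp ψ T‖ ≤ ‖ψ‖ * ‖T‖ := by
  refine ContinuousLinearMap.opNorm_le_bound _ (by positivity) fun c => ?_
  set e := sliceOp ψ T c with he
  rcases (norm_nonneg e).eq_or_lt with h0 | h0
  · rw [← h0]; positivity
  refine le_of_mul_le_mul_right ?_ h0
  calc ‖e‖ * ‖e‖ = ‖inner ℂ e (sliceOp ψ T c)‖ := by
        rw [← he, inner_self_eq_norm_sq_to_K]; simp [sq]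
    _ = ‖ψ (sandwich T e c)‖ := by rw [inner_sliceOp]
    _ ≤ ‖ψ‖ * (‖T‖ * ‖e‖ * ‖c‖) :=
        (ψ.le_opNorm _).trans (by gcongr; exact norm_sandwich_le T e c)
    _ = ‖ψ‖ * ‖T‖ * ‖c‖ * ‖e‖ := by ring

variable (Γ) in
/-- The slice map `id ⊗ ψ` from operators on `ℓ²(Γ, H)` to operators on `ℓ²(Γ)`. -/
def slice (ψ : StrongDual ℂ (H →L[ℂ] H)) :
    (EllTwo Γ H →L[ℂ] EllTwo Γ H) →L[ℂ] (EllTwo Γ ℂ →L[ℂ] EllTwo Γ ℂ) :=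
  LinearMap.mkContinuous
    { toFun := sliceOp ψ
      map_add' := fun S T => ContinuousLinearMap.ext fun c => ext_inner_left ℂ fun d => by
        rw [add_apply, inner_add_right, inner_sliceOp, inner_sliceOp,
          inner_sliceOp, ← map_add]
        congr 1
        ext v
        simp [sandwich]
      map_smul' := fun z T => ContinuousLinearMap.ext fun c => ext_inner_left ℂ fun d => by
        rw [RingHom.id_apply, smul_apply, inner_smul_right, inner_sliceOp,
          inner_sliceOp, ← smul_eq_mul, ← map_smul]
        congr 1
        ext v
        simp [sandwich] }
    ‖ψ‖ (norm_sliceOp_le ψ)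

theorem inner_slice (ψ : StrongDual ℂ (H →L[ℂ] H)) (T : EllTwo Γ H →L[ℂ] EllTwo Γ H)
    (d c : EllTwo Γ ℂ) : inner ℂ d (slice Γ ψ T c) = ψ (sandwich T d c) :=
  inner_sliceOp ψ T d c

end Slice

/-! ### Slicing by an invariant functional -/

section CrossedProduct

variable {Γ : Type*} [Group Γ] {A : Type*} [CStarAlgebra A] (α : Γ →* (A ≃⋆ₐ[ℂ] A))
variable {H : Type*} [NormedAddCommGroup H] [InnerProductSpace ℂ H] [CompleteSpace H]
variable (π : A →⋆ₐ[ℂ] (H →L[ℂ] H))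

open Classical in
theorem sandwich_sigma_mul_leftReg (a : A) (s t u : Γ) (z : ℂ) :
    sandwich (sigma α π a * leftReg Γ H s) (lp.single (E := fun _ : Γ => ℂ) 2 u 1)
      (lp.single (E := fun _ : Γ => ℂ) 2 t z) =
      if s⁻¹ * u = t then z • π (α u⁻¹ a) else 0 := by
  ext w
  refine ext_inner_left ℂ fun v => ?_
  rw [inner_sandwich, elementaryTensor_single, elementaryTensor_single, lp.inner_single_left,
    mul_apply_eq_comp, sigma_apply, leftReg_apply, lp.single_apply, one_smul]
  by_cases h : s⁻¹ * u = t
  · subst h; simp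
  · simp [h]

variable {π} in
/-- A `Γ`-invariant bounded functional `f` on `A` extends to a slice map
`σ(a) λ_s ↦ f(a) λ_s` on operators. -/
theorem exists_slice_sigma_mul_leftReg (hπ : Function.Injective π) (f : StrongDual ℂ A)
    (hf : ∀ g a, f (α g a) = f a) :
    ∃ E : (EllTwo Γ H →L[ℂ] EllTwo Γ H) →L[ℂ] (EllTwo Γ ℂ →L[ℂ] EllTwo Γ ℂ),
      ∀ a s, E (sigma α π a * leftReg Γ H s) = f a • leftReg Γ ℂ s := by
  classical
  -- Hahn–Banach extends `f` from `π(A)` to `B(H)`. Only boundedness of the extension matters, not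
  -- positivity.
  obtain ⟨ψ, hψ, -⟩ := exists_extension_norm_eq (LinearMap.range (repIsometry hπ).toLinearMap)
    (f.comp ((repIsometry hπ).equivRange.symm.toContinuousLinearEquiv :
      LinearMap.range (repIsometry hπ).toLinearMap →L[ℂ] A))
  have hψπ (a : A) : ψ (π a) = f a := by
    refine (hψ ⟨π a, a, rfl⟩).trans (congrArg f ?_)
    exact (repIsometry hπ).equivRange.symm_apply_apply a
  refine ⟨slice Γ ψ, fun a s => ?_⟩
  refine ext_single fun t z => ?_
  ext u
  have h (ξ : EllTwo Γ ℂ) : ξ u = inner ℂ (lp.single (E := fun _ : Γ => ℂ) 2 u 1) ξ := by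
    rw [lp.inner_single_left]; simp
  rw [h, inner_slice, sandwich_sigma_mul_leftReg, smul_apply, lp.coeFn_smul,
    Pi.smul_apply, leftReg_apply, lp.single_apply]
  -- The nonzero entry in row `u` is `π (α u⁻¹ a)`; invariance of `f` makes its value under `ψ`
  -- independent of `u`.
  by_cases hu : s⁻¹ * u = t
  · subst hu
    simp [-map_inv, hψπ, hf, mul_comm]
  · simp [hu]

end CrossedProduct

/-- A bounded linear map with values in the range of a linear isometry lifts along it. -/
theorem LinearIsometry.exists_lift {X Y Z : Type*} [NormedAddCommGroup X] [NormedSpace ℂ X]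
    [NormedAddCommGroup Y] [NormedSpace ℂ Y] [NormedAddCommGroup Z] [NormedSpace ℂ Z]
    (J : X →ₗᵢ[ℂ] Y) (F : Z →L[ℂ] Y) (hF : ∀ z, F z ∈ LinearMap.range J.toLinearMap) :
    ∃ Φ : Z →L[ℂ] X, ∀ z, J (Φ z) = F z :=
  ⟨(J.equivRange.symm.toContinuousLinearEquiv : LinearMap.range J.toLinearMap →L[ℂ] X).comp
    (F.codRestrict (LinearMap.range J.toLinearMap) hF), fun z =>
    congrArg Subtype.val (J.equivRange.apply_symm_apply ⟨F z, hF z⟩)⟩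

/-! ### The projection onto `C⋆_r(Γ)` -/

section Expectation

variable {Γ : Type*} [Group Γ] {A : Type*} [CStarAlgebra A] {α : Γ →* (A ≃⋆ₐ[ℂ] A)}
variable {H : Type*} [NormedAddCommGroup H] [InnerProductSpace ℂ H] [CompleteSpace H]
variable {π : A →⋆ₐ[ℂ] (H →L[ℂ] H)}

theorem eq_of_mem_reducedGroupCStar {E : Type*} [NormedAddCommGroup E] [NormedSpace ℂ E]
    {F G : (EllTwo Γ H →L[ℂ] EllTwo Γ H) →L[ℂ] E}
    (h : ∀ s, F (leftReg Γ H s) = G (leftReg Γ H s)) {T : EllTwo Γ H →L[ℂ] EllTwo Γ H}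
    (hT : T ∈ reducedGroupCStar Γ H) : F T = G T :=
  mem_of_mem_reducedGroupCStar hT (LinearMap.eqLocus F.toLinearMap G.toLinearMap)
    (isClosed_eq F.continuous G.continuous) h

theorem eq_of_mem_reducedCrossedProduct {E : Type*} [NormedAddCommGroup E] [NormedSpace ℂ E]
    {F G : (EllTwo Γ H →L[ℂ] EllTwo Γ H) →L[ℂ] E}
    (h : ∀ a s, F (sigma α π a * leftReg Γ H s) = G (sigma α π a * leftReg Γ H s))
    {T : EllTwo Γ H →L[ℂ] EllTwo Γ H} (hT : T ∈ reducedCrossedProduct α π) : F T = G T :=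
  mem_of_mem_reducedCrossedProduct hT (LinearMap.eqLocus F.toLinearMap G.toLinearMap)
    (isClosed_eq F.continuous G.continuous) h

variable {E : (EllTwo Γ H →L[ℂ] EllTwo Γ H) →L[ℂ] (EllTwo Γ ℂ →L[ℂ] EllTwo Γ ℂ)}
variable {f : StrongDual ℂ A}

/-- Moving `λ_s` past `σ(a)` replaces `a` by `α s a`, which `f` does not see. Linearity and
continuity in each variable do the rest. -/
theorem slice_leftReg_mul (hf : ∀ g a, f (α g a) = f a)
    (hE : ∀ a s, E (sigma α π a * leftReg Γ H s) = f a • leftReg Γ ℂ s)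
    (hEl : ∀ s, E (leftReg Γ H s) = leftReg Γ ℂ s)
    {c x : EllTwo Γ H →L[ℂ] EllTwo Γ H} (hc : c ∈ reducedGroupCStar Γ H)
    (hx : x ∈ reducedCrossedProduct α π) : E (c * x) = E c * E x := by
  refine eq_of_mem_reducedGroupCStar
    (F := E.comp ((ContinuousLinearMap.mul ℂ _).flip x))
    (G := ((ContinuousLinearMap.mul ℂ _).flip (E x)).comp E) (fun s => ?_) hc
  refine eq_of_mem_reducedCrossedProduct
    (F := E.comp (ContinuousLinearMap.mul ℂ _ (leftReg Γ H s)))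
    (G := (ContinuousLinearMap.mul ℂ _ (E (leftReg Γ H s))).comp E) (fun a t => ?_) hx
  change E (leftReg Γ H s * (sigma α π a * leftReg Γ H t)) =
    E (leftReg Γ H s) * E (sigma α π a * leftReg Γ H t)
  rw [← mul_assoc, leftReg_mul_sigma, mul_assoc, ← map_mul, hE, hE, hEl, hf, map_mul, mul_smul_comm]

theorem slice_mul_leftReg
    (hE : ∀ a s, E (sigma α π a * leftReg Γ H s) = f a • leftReg Γ ℂ s)
    (hEl : ∀ s, E (leftReg Γ H s) = leftReg Γ ℂ s)
    {c x : EllTwo Γ H →L[ℂ] EllTwo Γ H} (hc : c ∈ reducedGroupCStar Γ H)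
    (hx : x ∈ reducedCrossedProduct α π) : E (x * c) = E x * E c := by
  refine eq_of_mem_reducedGroupCStar
    (F := E.comp (ContinuousLinearMap.mul ℂ _ x))
    (G := (ContinuousLinearMap.mul ℂ _ (E x)).comp E) (fun s => ?_) hc
  refine eq_of_mem_reducedCrossedProduct
    (F := E.comp ((ContinuousLinearMap.mul ℂ _).flip (leftReg Γ H s)))
    (G := ((ContinuousLinearMap.mul ℂ _).flip (E (leftReg Γ H s))).comp E) (fun a t => ?_) hx
  change E (sigma α π a * leftReg Γ H t * leftReg Γ H s) =
    E (sigma α π a * leftReg Γ H t) * E (leftReg Γ H s)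
  rw [mul_assoc, ← map_mul, hE, hE, hEl, map_mul, smul_mul_assoc]

theorem slice_star (hEl : ∀ s, E (leftReg Γ H s) = leftReg Γ ℂ s)
    {c : EllTwo Γ H →L[ℂ] EllTwo Γ H} (hc : c ∈ reducedGroupCStar Γ H) :
    E (star c) = star (E c) := by
  -- Both sides are conjugate-linear in `T`, so their equality still cuts out a complex subspace.
  let p : Submodule ℂ (EllTwo Γ H →L[ℂ] EllTwo Γ H) :=
    { carrier := {T | E (star T) = star (E T)}
      add_mem' := fun {S T} hS hT => by
        simp only [Set.mem_ofPred_eq] at hS hT ⊢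
        rw [star_add, map_add, map_add, star_add, hS, hT]
      zero_mem' := by simp
      smul_mem' := fun z T hT => by
        simp only [Set.mem_ofPred_eq] at hT ⊢
        rw [star_smul, map_smul, map_smul, star_smul, hT] }
  refine mem_of_mem_reducedGroupCStar hc p
    (isClosed_eq (E.continuous.comp continuous_star) (continuous_star.comp E.continuous)) fun s => ?_
  change E (star (leftReg Γ H s)) = star (E (leftReg Γ H s))
  rw [star_leftReg, hEl, hEl, star_leftReg]

/-- `E` intertwines the canonical traces on `ℓ²(Γ, H)` and `ℓ²(Γ)`. As `E (c⋆c) = E (c⋆) E c = 0`,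
the trace of `c⋆c` vanishes, and the trace is faithful. -/
theorem eq_zero_of_slice_eq_zero
    (hEl : ∀ s, E (leftReg Γ H s) = leftReg Γ ℂ s)
    (hmul : ∀ c ∈ reducedGroupCStar Γ H, ∀ d ∈ reducedGroupCStar Γ H, E (c * d) = E c * E d)
    {c : EllTwo Γ H →L[ℂ] EllTwo Γ H} (hc : c ∈ reducedGroupCStar Γ H) (h : E c = 0) : c = 0 := by
  classical
  refine eq_zero_of_compression_star_mul_self hc ?_
  have key (T : EllTwo Γ H →L[ℂ] EllTwo Γ H) (hT : T ∈ reducedGroupCStar Γ H) :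
      compression T = (compression (E T) 1) • (1 : H →L[ℂ] H) := by
    refine eq_of_mem_reducedGroupCStar (F := compression)
      (G := (((ContinuousLinearMap.apply ℂ ℂ (1 : ℂ)).comp
        (compression (Γ := Γ) (H := ℂ))).comp E).smulRight (1 : H →L[ℂ] H)) (fun s => ?_) hT
    change compression (leftReg Γ H s) =
      (compression (E (leftReg Γ H s)) 1) • (1 : H →L[ℂ] H)
    rw [hEl, compression_leftReg, compression_leftReg]
    split_ifs <;> simp
  rw [key _ (mul_mem (star_mem hc) hc), hmul _ (star_mem hc) _ hc, h, mul_zero, map_zero]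
  simp

/-- A unital slice map fixing the translations is isometric on `C⋆_r(Γ)`. -/
theorem exists_linearIsometry_slice (hE1 : E 1 = 1)
    (hEl : ∀ s, E (leftReg Γ H s) = leftReg Γ ℂ s)
    (hmul : ∀ c ∈ reducedGroupCStar Γ H, ∀ d ∈ reducedGroupCStar Γ H, E (c * d) = E c * E d) :
    ∃ J : reducedGroupCStar Γ H →ₗᵢ[ℂ] (EllTwo Γ ℂ →L[ℂ] EllTwo Γ ℂ),
      ∀ c : reducedGroupCStar Γ H, J c = E c := by
  -- Closedness makes `C⋆_r(Γ)` a C⋆-algebra, so that the injective `*`-homomorphism `j` is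
  -- automatically isometric.
  have hclosed := isClosed_reducedGroupCStar Γ H
  let j : reducedGroupCStar Γ H →⋆ₐ[ℂ] (EllTwo Γ ℂ →L[ℂ] EllTwo Γ ℂ) :=
    { toFun := fun c => E c
      map_one' := hE1
      map_mul' := fun c d => hmul c c.2 d d.2
      map_zero' := map_zero E
      map_add' := fun c d => map_add E _ _
      commutes' := fun z => by
        rw [Algebra.algebraMap_eq_smul_one, Algebra.algebraMap_eq_smul_one, ← hE1]
        exact map_smul E z 1
      map_star' := fun c => slice_star hEl c.2 }
  have hj : Function.Injective j := by
    refine (injective_iff_map_eq_zero j).2 fun c hc => ?_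
    exact Subtype.ext (eq_zero_of_slice_eq_zero hEl hmul c.2 hc)
  exact ⟨{ toLinearMap := j.toAlgHom.toLinearMap
           norm_map' := fun c => NonUnitalStarAlgHom.norm_map j hj c }, fun c => rfl⟩

set_option maxHeartbeats 800000 in
variable (α) in
/-- A `Γ`-invariant bounded functional `f` on `A` with `f 1 = 1` induces a bounded
`C⋆_r(Γ)`-bimodule projection of the reduced crossed product onto `C⋆_r(Γ)`. -/
theorem exists_expectation_reducedGroupCStar (hπ : Function.Injective π) (f : StrongDual ℂ A)
    (hf : ∀ g a, f (α g a) = f a) (hf1 : f 1 = 1) :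
    ∃ Φ : reducedCrossedProduct α π →L[ℂ] reducedGroupCStar Γ H,
      (∀ (a : A) (h : sigma α π a ∈ reducedCrossedProduct α π), Φ ⟨sigma α π a, h⟩ = f a • 1) ∧
      (∀ (c : reducedGroupCStar Γ H)
        (h : (c : EllTwo Γ H →L[ℂ] EllTwo Γ H) ∈ reducedCrossedProduct α π), Φ ⟨c, h⟩ = c) ∧
      ∀ (c d : reducedGroupCStar Γ H) (x : reducedCrossedProduct α π)
        (h : (c : EllTwo Γ H →L[ℂ] EllTwo Γ H) * x * d ∈ reducedCrossedProduct α π),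
        Φ ⟨c * x * d, h⟩ = c * Φ x * d := by
  obtain ⟨E, hE⟩ := exists_slice_sigma_mul_leftReg α hπ f hf
  have hEl (s : Γ) : E (leftReg Γ H s) = leftReg Γ ℂ s := by simpa [hf1] using hE 1 s
  have hE1 : E 1 = 1 := by simpa using hEl 1
  have hCM := reducedGroupCStar_le_reducedCrossedProduct α π
  have hmul (c : EllTwo Γ H →L[ℂ] EllTwo Γ H) (hc : c ∈ reducedGroupCStar Γ H)
      (d : EllTwo Γ H →L[ℂ] EllTwo Γ H) (hd : d ∈ reducedGroupCStar Γ H) :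
      E (c * d) = E c * E d := slice_leftReg_mul hf hE hEl hc (hCM hd)
  have hcomplete : CompleteSpace (reducedGroupCStar Γ H) :=
    (isClosed_reducedGroupCStar Γ H).completeSpace_coe
  obtain ⟨J, hJ⟩ := exists_linearIsometry_slice hE1 hEl hmul
  have hJr : IsClosed (LinearMap.range J.toLinearMap : Set (EllTwo Γ ℂ →L[ℂ] EllTwo Γ ℂ)) := by
    rw [LinearMap.coe_range]
    exact J.isometry.isClosedEmbedding.isClosed_range
  -- On generators `E (σ(a) λ_s) = f(a) E (λ_s)` lies in the range of `J`, and this range is closed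
  -- because `J` is isometric on a complete space. Hence `E` lifts along `J` to `Φ`.
  have hER (x : reducedCrossedProduct α π) :
      E (x : EllTwo Γ H →L[ℂ] EllTwo Γ H) ∈ LinearMap.range J.toLinearMap := by
    refine mem_of_mem_reducedCrossedProduct x.2 ((LinearMap.range J.toLinearMap).comap
      E.toLinearMap) (hJr.preimage E.continuous) fun a s => ?_
    have h1 : E (sigma α π a * leftReg Γ H s) = f a • E (leftReg Γ H s) := by
      rw [hEl]; exact hE a s
    have h2 : E (leftReg Γ H s) ∈ LinearMap.range J.toLinearMap :=
      ⟨⟨_, leftReg_mem_reducedGroupCStar s⟩, hJ _⟩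
    have h3 := (LinearMap.range J.toLinearMap).smul_mem (f a) h2
    rw [← h1] at h3
    exact h3
  let F : reducedCrossedProduct α π →L[ℂ] (EllTwo Γ ℂ →L[ℂ] EllTwo Γ ℂ) :=
    E.comp (reducedCrossedProduct α π).toSubalgebra.toSubmodule.subtypeL
  obtain ⟨Φ, hΦ⟩ := J.exists_lift F hER
  replace hΦ (x : reducedCrossedProduct α π) : E (Φ x : EllTwo Γ H →L[ℂ] EllTwo Γ H) = E x :=
    (hJ _).symm.trans (hΦ x)
  -- Since `J` is injective, every identity for `Φ` may be verified after applying `E`.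
  have huniq (x : reducedCrossedProduct α π) (c : reducedGroupCStar Γ H)
      (h : E (x : EllTwo Γ H →L[ℂ] EllTwo Γ H) = E c) : Φ x = c :=
    J.injective (by rw [hJ, hJ, hΦ, h])
  refine ⟨Φ, fun a h => huniq _ _ ?_, fun c h => huniq _ _ rfl, fun c d x h => huniq _ _ ?_⟩
  · change E (sigma α π a) = E (f a • 1)
    rw [map_smul, hE1]
    simpa using hE a 1
  · change E (c * x * d) = E (c * (Φ x : EllTwo Γ H →L[ℂ] EllTwo Γ H) * d)
    rw [slice_mul_leftReg hE hEl d.2 (mul_mem (hCM c.2) x.2), slice_leftReg_mul hf hE hEl c.2 x.2,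
      hmul _ (mul_mem c.2 (Φ x).2) _ d.2, hmul _ c.2 _ (Φ x).2, hΦ]

end Expectation

/-! ### The algebra generated by `C⋆_r(Γ)` and `A_I` -/

section IdealAlgebra

variable {Γ : Type*} [Group Γ] {A : Type*} [CStarAlgebra A] {α : Γ →* (A ≃⋆ₐ[ℂ] A)}
variable {H : Type*} [NormedAddCommGroup H] [InnerProductSpace ℂ H] [CompleteSpace H]
variable {π : A →⋆ₐ[ℂ] (H →L[ℂ] H)} {I : Ideal (reducedGroupCStar Γ H)}

theorem mul_mul_mem_idealSpan {η η' : reducedGroupCStar Γ H} (hη : η ∈ I) (hη' : η' ∈ I)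
    {x : EllTwo Γ H →L[ℂ] EllTwo Γ H} (hx : x ∈ reducedCrossedProduct α π) :
    (η : EllTwo Γ H →L[ℂ] EllTwo Γ H) * x * η' ∈ idealSpan α π I :=
  Submodule.subset_span ⟨η, hη, x, hx, η', hη', rfl⟩

theorem idealSpan_le_reducedCrossedProduct :
    idealSpan α π I ≤ (reducedCrossedProduct α π).toSubalgebra.toSubmodule := by
  refine Submodule.span_le.2 ?_
  rintro _ ⟨η, -, x, hx, η', -, rfl⟩
  have hCM := reducedGroupCStar_le_reducedCrossedProduct α π
  have h : (η : EllTwo Γ H →L[ℂ] EllTwo Γ H) * x * η' ∈ reducedCrossedProduct α π :=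
    mul_mem (mul_mem (hCM η.2) hx) (hCM η'.2)
  exact h

theorem topologicalClosure_idealSpan_le_reducedCrossedProduct :
    (idealSpan α π I).topologicalClosure ≤
      (reducedCrossedProduct α π).toSubalgebra.toSubmodule :=
  Submodule.topologicalClosure_minimal _ idealSpan_le_reducedCrossedProduct
    (isClosed_reducedCrossedProduct α π)

theorem left_mul_mem_idealSpan_closure {c T : EllTwo Γ H →L[ℂ] EllTwo Γ H}
    (hc : c ∈ reducedGroupCStar Γ H) (hT : T ∈ (idealSpan α π I).topologicalClosure) :
    c * T ∈ (idealSpan α π I).topologicalClosure := by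
  refine map_mem_closure (f := fun T => c * T) (by fun_prop) hT fun T hT => ?_
  have h : idealSpan α π I ≤ (idealSpan α π I).comap (LinearMap.mulLeft ℂ c) := by
    refine Submodule.span_le.2 ?_
    rintro _ ⟨η, hη, x, hx, η', hη', rfl⟩
    change c * (η * x * η') ∈ idealSpan α π I
    rw [← mul_assoc, ← mul_assoc]
    exact mul_mul_mem_idealSpan (I.mul_mem_left ⟨c, hc⟩ hη) hη' hx
  exact h hT

theorem right_mul_mem_idealSpan_closure [I.IsTwoSided] {c T : EllTwo Γ H →L[ℂ] EllTwo Γ H}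
    (hc : c ∈ reducedGroupCStar Γ H) (hT : T ∈ (idealSpan α π I).topologicalClosure) :
    T * c ∈ (idealSpan α π I).topologicalClosure := by
  refine map_mem_closure (f := fun T => T * c) (by fun_prop) hT fun T hT => ?_
  have h : idealSpan α π I ≤ (idealSpan α π I).comap (LinearMap.mulRight ℂ c) := by
    refine Submodule.span_le.2 ?_
    rintro _ ⟨η, hη, x, hx, η', hη', rfl⟩
    change (η : EllTwo Γ H →L[ℂ] EllTwo Γ H) * x * η' * c ∈ idealSpan α π I
    rw [mul_assoc]
    exact mul_mul_mem_idealSpan hη (I.mul_mem_right ⟨c, hc⟩ hη') hx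
  exact h hT

theorem mul_mem_idealSpan_closure {S T : EllTwo Γ H →L[ℂ] EllTwo Γ H}
    (hS : S ∈ (idealSpan α π I).topologicalClosure)
    (hT : T ∈ (idealSpan α π I).topologicalClosure) :
    S * T ∈ (idealSpan α π I).topologicalClosure := by
  refine map_mem_closure₂ (f := fun S T => S * T) (by fun_prop) hS hT fun S hS T hT => ?_
  have h : idealSpan α π I * idealSpan α π I ≤ idealSpan α π I := by
    rw [idealSpan, Submodule.span_mul_span, Submodule.span_le]
    rintro _ ⟨_, ⟨η, hη, x, hx, η', hη', rfl⟩, _, ⟨ζ, hζ, y, hy, ζ', hζ', rfl⟩, rfl⟩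
    have hCM := reducedGroupCStar_le_reducedCrossedProduct α π
    have e : (η : EllTwo Γ H →L[ℂ] EllTwo Γ H) * x * η' * (ζ * y * ζ') =
        η * (x * η' * ζ * y) * ζ' := by simp only [mul_assoc]
    change (η : EllTwo Γ H →L[ℂ] EllTwo Γ H) * x * η' * (ζ * y * ζ') ∈ idealSpan α π I
    rw [e]
    exact mul_mul_mem_idealSpan hη hζ' (mul_mem (mul_mem (mul_mem hx (hCM η'.2)) (hCM ζ.2)) hy)
  exact h (Submodule.mul_mem_mul hS hT)

theorem star_mem_of_mem_ideal [I.IsTwoSided] (hI : IsClosed (I : Set (reducedGroupCStar Γ H)))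
    {η : reducedGroupCStar Γ H} (hη : η ∈ I) : star η ∈ I := by
  have hclosed := isClosed_reducedGroupCStar Γ H
  exact I.star_mem_of_isClosed hI hη

theorem star_mem_idealSpan_closure [I.IsTwoSided]
    (hI : IsClosed (I : Set (reducedGroupCStar Γ H))) {T : EllTwo Γ H →L[ℂ] EllTwo Γ H}
    (hT : T ∈ (idealSpan α π I).topologicalClosure) :
    star T ∈ (idealSpan α π I).topologicalClosure := by
  refine map_mem_closure continuous_star hT fun T hT => ?_
  refine Submodule.span_induction (p := fun T _ => star T ∈ idealSpan α π I) ?_ ?_ ?_ ?_ hT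
  · rintro _ ⟨η, hη, x, hx, η', hη', rfl⟩
    rw [star_mul, star_mul, ← mul_assoc]
    exact mul_mul_mem_idealSpan (star_mem_of_mem_ideal hI hη') (star_mem_of_mem_ideal hI hη)
      (star_mem hx)
  · simp
  · intro x y _ _ hx hy
    rw [star_add]
    exact add_mem hx hy
  · intro z x _ hx
    rw [star_smul]
    exact Submodule.smul_mem _ _ hx

/-- `η` is a limit of `η u = η · 1 · u` with `u ∈ I`. -/
theorem coe_mem_idealSpan_closure [I.IsTwoSided] (hI : IsClosed (I : Set (reducedGroupCStar Γ H)))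
    {η : reducedGroupCStar Γ H} (hη : η ∈ I) :
    (η : EllTwo Γ H →L[ℂ] EllTwo Γ H) ∈ (idealSpan α π I).topologicalClosure := by
  have hclosed := isClosed_reducedGroupCStar Γ H
  refine Metric.mem_closure_iff.2 fun ε hε => ?_
  obtain ⟨u, hu, h⟩ := I.exists_norm_sub_mul_lt hI hη hε
  refine ⟨η * u, ?_, ?_⟩
  · simpa using mul_mul_mem_idealSpan (α := α) (π := π) hη hu (one_mem _)
  · rw [dist_eq_norm]
    exact h

variable (α π) in
/-- The C⋆-algebra `C⋆_r(Γ) + closure A_I`. -/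
def idealStarSubalgebra (I : Ideal (reducedGroupCStar Γ H)) [I.IsTwoSided]
    (hI : IsClosed (I : Set (reducedGroupCStar Γ H))) :
    StarSubalgebra ℂ (EllTwo Γ H →L[ℂ] EllTwo Γ H) where
  carrier := idealAlgebra α π I
  mul_mem' := by
    intro S T hS hT
    obtain ⟨c, hc, S, hS', rfl⟩ := Submodule.mem_sup.1 hS
    obtain ⟨d, hd, T, hT', rfl⟩ := Submodule.mem_sup.1 hT
    have hcd : c * d ∈ reducedGroupCStar Γ H := mul_mem hc hd
    have e : (c + S) * (d + T) = c * d + (c * T + S * d + S * T) := by noncomm_ring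
    rw [e]
    exact Submodule.add_mem_sup hcd (add_mem (add_mem (left_mul_mem_idealSpan_closure hc hT')
      (right_mul_mem_idealSpan_closure hd hS')) (mul_mem_idealSpan_closure hS' hT'))
  add_mem' := add_mem
  algebraMap_mem' z := Submodule.mem_sup_left
    (algebraMap_mem (S := StarSubalgebra ℂ (EllTwo Γ H →L[ℂ] EllTwo Γ H)) _ z)
  star_mem' := by
    intro S hS
    obtain ⟨c, hc, S, hS', rfl⟩ := Submodule.mem_sup.1 hS
    have hc' : star c ∈ reducedGroupCStar Γ H := star_mem hc
    rw [star_add]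
    exact Submodule.add_mem_sup hc' (star_mem_idealSpan_closure hI hS')

theorem reducedGroupCStar_le_idealStarSubalgebra [I.IsTwoSided]
    (hI : IsClosed (I : Set (reducedGroupCStar Γ H))) :
    reducedGroupCStar Γ H ≤ idealStarSubalgebra α π I hI :=
  fun _ hc => Submodule.mem_sup_left hc

theorem idealSpan_le_idealAlgebra : idealSpan α π I ≤ idealAlgebra α π I :=
  (Submodule.le_topologicalClosure _).trans le_sup_right

theorem idealStarSubalgebra_le_reducedCrossedProduct [I.IsTwoSided]
    (hI : IsClosed (I : Set (reducedGroupCStar Γ H))) :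
    idealStarSubalgebra α π I hI ≤ reducedCrossedProduct α π := by
  have h : idealAlgebra α π I ≤ (reducedCrossedProduct α π).toSubalgebra.toSubmodule :=
    sup_le (reducedGroupCStar_le_reducedCrossedProduct α π)
      topologicalClosure_idealSpan_le_reducedCrossedProduct
  exact h

section Expectation

variable {Φ : reducedCrossedProduct α π →L[ℂ] reducedGroupCStar Γ H}

/-- `Φ (η x η') = η Φ(x) η'` lies in `I`; continuity of `Φ` and closedness of `I` extend this to
limits. -/
theorem expectation_mem_ideal [I.IsTwoSided] (hI : IsClosed (I : Set (reducedGroupCStar Γ H)))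
    (hΦ : ∀ (c d : reducedGroupCStar Γ H) (x : reducedCrossedProduct α π)
      (h : (c : EllTwo Γ H →L[ℂ] EllTwo Γ H) * x * d ∈ reducedCrossedProduct α π),
      Φ ⟨c * x * d, h⟩ = c * Φ x * d)
    (x : reducedCrossedProduct α π)
    (hx : (x : EllTwo Γ H →L[ℂ] EllTwo Γ H) ∈ (idealSpan α π I).topologicalClosure) :
    Φ x ∈ I := by
  have hspan : ∀ T ∈ idealSpan α π I, ∃ h : T ∈ reducedCrossedProduct α π, Φ ⟨T, h⟩ ∈ I := by
    intro T hT
    refine Submodule.span_induction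
      (p := fun T _ => ∃ h : T ∈ reducedCrossedProduct α π, Φ ⟨T, h⟩ ∈ I) ?_ ?_ ?_ ?_ hT
    · rintro _ ⟨η, hη, x, hx, η', hη', rfl⟩
      have hM := idealSpan_le_reducedCrossedProduct
        (mul_mul_mem_idealSpan (α := α) (π := π) hη hη' hx)
      refine ⟨hM, ?_⟩
      rw [hΦ η η' ⟨x, hx⟩ hM]
      exact I.mul_mem_left _ hη'
    · exact ⟨zero_mem _, by
        have : Φ ⟨0, zero_mem _⟩ = 0 := map_zero Φ
        rw [this]; exact zero_mem _⟩
    · rintro S T - - ⟨hS, hSI⟩ ⟨hT, hTI⟩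
      refine ⟨add_mem hS hT, ?_⟩
      have : Φ ⟨S + T, add_mem hS hT⟩ = Φ ⟨S, hS⟩ + Φ ⟨T, hT⟩ := map_add Φ ⟨S, hS⟩ ⟨T, hT⟩
      rw [this]
      exact add_mem hSI hTI
    · rintro z T - ⟨hT, hTI⟩
      refine ⟨SMulMemClass.smul_mem z hT, ?_⟩
      have : Φ ⟨z • T, SMulMemClass.smul_mem z hT⟩ = z • Φ ⟨T, hT⟩ := map_smul Φ z ⟨T, hT⟩
      rw [this, ← smul_one_mul]
      exact I.mul_mem_left _ hTI
  obtain ⟨u, hu, hux⟩ := mem_closure_iff_seq_limit.1 hx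
  choose huM huI using fun n => hspan (u n) (hu n)
  refine hI.mem_of_tendsto (f := fun n => Φ ⟨u n, huM n⟩) (b := atTop) ?_
    (Eventually.of_forall huI)
  exact (Φ.continuous.tendsto x).comp (tendsto_subtype_rng.2 hux)

/-- If `x = c + T`, then `x - Φ x = T - Φ T`, and `Φ T ∈ I` is itself in the closure of `A_I`. -/
theorem mem_idealAlgebra_iff [I.IsTwoSided] (hI : IsClosed (I : Set (reducedGroupCStar Γ H)))
    (hΦC : ∀ (c : reducedGroupCStar Γ H)
      (h : (c : EllTwo Γ H →L[ℂ] EllTwo Γ H) ∈ reducedCrossedProduct α π), Φ ⟨c, h⟩ = c)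
    (hΦ : ∀ (c d : reducedGroupCStar Γ H) (x : reducedCrossedProduct α π)
      (h : (c : EllTwo Γ H →L[ℂ] EllTwo Γ H) * x * d ∈ reducedCrossedProduct α π),
      Φ ⟨c * x * d, h⟩ = c * Φ x * d)
    (x : reducedCrossedProduct α π) :
    (x : EllTwo Γ H →L[ℂ] EllTwo Γ H) ∈ idealAlgebra α π I ↔
      (x : EllTwo Γ H →L[ℂ] EllTwo Γ H) - Φ x ∈ (idealSpan α π I).topologicalClosure := by
  constructor
  · intro h
    obtain ⟨c, hc, T, hT, hcT⟩ := Submodule.mem_sup.1 h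
    have hcM : c ∈ reducedCrossedProduct α π := reducedGroupCStar_le_reducedCrossedProduct α π hc
    have hTM : T ∈ reducedCrossedProduct α π :=
      topologicalClosure_idealSpan_le_reducedCrossedProduct hT
    have hx : x = ⟨c, hcM⟩ + ⟨T, hTM⟩ := Subtype.ext hcT.symm
    have h1 : Φ x = ⟨c, hc⟩ + Φ ⟨T, hTM⟩ := by
      rw [hx, map_add]
      exact congrArg (· + _) (hΦC ⟨c, hc⟩ hcM)
    have h2 : (x : EllTwo Γ H →L[ℂ] EllTwo Γ H) - Φ x =
        T - (Φ ⟨T, hTM⟩ : EllTwo Γ H →L[ℂ] EllTwo Γ H) := by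
      rw [h1, ← hcT]
      exact add_sub_add_left_eq_sub _ _ _
    rw [h2]
    exact sub_mem hT (coe_mem_idealSpan_closure hI (expectation_mem_ideal hI hΦ ⟨T, hTM⟩ hT))
  · intro h
    exact Submodule.mem_sup.2 ⟨Φ x, (Φ x).2, _, h, add_sub_cancel _ _⟩

/-- A sum of two closed subspaces need not be closed; here it is the preimage of a closed subspace
under the continuous map `x ↦ x - Φ x`. -/
theorem isClosed_idealAlgebra [I.IsTwoSided] (hI : IsClosed (I : Set (reducedGroupCStar Γ H)))
    (hΦC : ∀ (c : reducedGroupCStar Γ H)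
      (h : (c : EllTwo Γ H →L[ℂ] EllTwo Γ H) ∈ reducedCrossedProduct α π), Φ ⟨c, h⟩ = c)
    (hΦ : ∀ (c d : reducedGroupCStar Γ H) (x : reducedCrossedProduct α π)
      (h : (c : EllTwo Γ H →L[ℂ] EllTwo Γ H) * x * d ∈ reducedCrossedProduct α π),
      Φ ⟨c * x * d, h⟩ = c * Φ x * d) :
    IsClosed (idealAlgebra α π I : Set (EllTwo Γ H →L[ℂ] EllTwo Γ H)) := by
  have h1 : IsClosed {x : reducedCrossedProduct α π | (x : EllTwo Γ H →L[ℂ] EllTwo Γ H) - Φ x ∈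
      (idealSpan α π I).topologicalClosure} :=
    (Submodule.isClosed_topologicalClosure _).preimage
      (continuous_subtype_val.sub (continuous_subtype_val.comp Φ.continuous))
  have h2 := (isClosed_reducedCrossedProduct α π).isClosedEmbedding_subtypeVal.isClosedMap _ h1
  convert h2 using 1
  ext T
  constructor
  · intro hT
    have hTM := idealStarSubalgebra_le_reducedCrossedProduct hI hT
    exact ⟨⟨T, hTM⟩, (mem_idealAlgebra_iff hI hΦC hΦ ⟨T, hTM⟩).1 hT, rfl⟩
  · rintro ⟨x, hx, rfl⟩
    exact (mem_idealAlgebra_iff hI hΦC hΦ x).2 hx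

end Expectation

theorem repIsometry_canonicalExpectation (hπ : Function.Injective π)
    (x : reducedCrossedProduct α π) :
    repIsometry hπ (canonicalExpectation α hπ x) =
      compression (x : EllTwo Γ H →L[ℂ] EllTwo Γ H) :=
  congrArg Subtype.val ((repIsometry hπ).equivRange.apply_symm_apply
    ⟨compression (x : EllTwo Γ H →L[ℂ] EllTwo Γ H), compression_mem_range α hπ x⟩)

set_option maxHeartbeats 800000 in
/-- For an i.c.c. group, `𝔼(A_I)` is dense in `A` for every nonzero two-sided ideal `I`. -/
theorem dense_canonicalExpectation_idealSpan (hΓ : IsICC Γ) (hπ : Function.Injective π)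
    [I.IsTwoSided] (hI_bot : I ≠ ⊥) :
    Dense (canonicalExpectation α hπ '' {x | (x : EllTwo Γ H →L[ℂ] EllTwo Γ H) ∈
      idealSpan α π I}) := by
  obtain ⟨η, hη, hη0⟩ := Submodule.exists_mem_ne_zero_of_ne_bot hI_bot
  -- Passing to `η⋆η` guarantees a nonzero trace `z`.
  have hyI : star η * η ∈ I := I.mul_mem_left _ hη
  have hy0 : compression ((star η * η : reducedGroupCStar Γ H) :
      EllTwo Γ H →L[ℂ] EllTwo Γ H) ≠ 0 := fun h =>
    hη0 (Subtype.ext (eq_zero_of_compression_star_mul_self η.2 h))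
  generalize star η * η = y at hyI hy0
  obtain ⟨z, hz⟩ := exists_compression_eq_smul_one y.2
  have hz0 : z ≠ 0 := by
    rintro rfl
    exact hy0 (by rw [hz, zero_smul])
  intro a
  -- The limit carries a factor `z²`, one `z` from each copy of `y`; the factor `z⁻²` cancels it.
  obtain ⟨h, hlim⟩ := exists_tendsto_compression_conj α π hΓ ((z⁻¹ * z⁻¹) • a) y.2 y.2
  have e : z • (1 : H →L[ℂ] H) * π ((z⁻¹ * z⁻¹) • a) * z • (1 : H →L[ℂ] H) =
      repIsometry hπ a := by
    change _ = π a
    rw [map_smul, smul_mul_assoc, one_mul, mul_smul_comm, mul_one, smul_smul, smul_smul,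
      show z * z * (z⁻¹ * z⁻¹) = 1 by field_simp, one_smul]
  rw [hz, e] at hlim
  have hx (n : ℕ) : ∃ x : reducedCrossedProduct α π,
      (x : EllTwo Γ H →L[ℂ] EllTwo Γ H) ∈ idealSpan α π I ∧
      (x : EllTwo Γ H →L[ℂ] EllTwo Γ H) = y * sigma α π ((z⁻¹ * z⁻¹) • a) *
        (leftReg Γ H (h n) * y * leftReg Γ H (h n)⁻¹) := by
    have hmem := mul_mul_mem_idealSpan (η' := ⟨_, leftReg_mem_reducedGroupCStar (h n)⟩ * y *
      ⟨_, leftReg_mem_reducedGroupCStar (h n)⁻¹⟩) hyI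
      (I.mul_mem_right _ (I.mul_mem_left _ hyI))
      (sigma_mem_reducedCrossedProduct α π ((z⁻¹ * z⁻¹) • a))
    exact ⟨⟨_, idealSpan_le_reducedCrossedProduct hmem⟩, hmem, rfl⟩
  choose x hxI hx using hx
  have hlim' : Tendsto (fun n => canonicalExpectation α hπ (x n)) atTop (𝓝 a) := by
    rw [(repIsometry hπ).isometry.isEmbedding.tendsto_nhds_iff]
    refine hlim.congr fun n => ?_
    rw [Function.comp_apply, repIsometry_canonicalExpectation, hx]
  exact mem_closure_of_tendsto hlim' (Eventually.of_forall fun n => ⟨x n, hxI n, rfl⟩)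

/-- The canonical expectation does not have dense range on `C⋆_r(Γ)` unless `A = ℂ`. -/
theorem not_le_reducedGroupCStar_of_dense (hA : ¬ Function.Surjective (algebraMap ℂ A))
    (hπ : Function.Injective π) {B : StarSubalgebra ℂ (EllTwo Γ H →L[ℂ] EllTwo Γ H)}
    (hB : Dense (canonicalExpectation α hπ '' {x | (x : EllTwo Γ H →L[ℂ] EllTwo Γ H) ∈ B})) :
    ¬ B ≤ reducedGroupCStar Γ H := by
  intro hle
  -- `𝔼` sends `C⋆_r(Γ)` into the scalars, which are closed in `A`; a dense image inside them would
  -- give `A = ℂ`.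
  have hcl : IsClosed (LinearMap.range (Algebra.linearMap ℂ A) : Set A) :=
    Submodule.closed_of_finiteDimensional _
  have hsub : canonicalExpectation α hπ '' {x | (x : EllTwo Γ H →L[ℂ] EllTwo Γ H) ∈ B} ⊆
      (LinearMap.range (Algebra.linearMap ℂ A) : Set A) := by
    rintro _ ⟨x, hx, rfl⟩
    obtain ⟨z, hz⟩ := exists_compression_eq_smul_one (hle hx)
    refine ⟨z, (repIsometry hπ).injective ?_⟩
    rw [repIsometry_canonicalExpectation, hz]
    change π (algebraMap ℂ A z) = _
    rw [AlgHomClass.commutes, Algebra.algebraMap_eq_smul_one]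
  refine hA fun a => ?_
  exact closure_minimal hsub hcl (hB a)

end IdealAlgebra

/-! ### Intersection with `A` and the final assembly -/

section Main

variable {Γ : Type*} [Group Γ] {A : Type*} [CStarAlgebra A] {α : Γ →* (A ≃⋆ₐ[ℂ] A)}
variable {H : Type*} [NormedAddCommGroup H] [InnerProductSpace ℂ H] [CompleteSpace H]
variable {π : A →⋆ₐ[ℂ] (H →L[ℂ] H)} {I : Ideal (reducedGroupCStar Γ H)}
variable {Φ : reducedCrossedProduct α π →L[ℂ] reducedGroupCStar Γ H}

/-- If the functional `f` is faithful, the elements of `A` in `C⋆_r(Γ) + closure A_I` are scalars. -/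
theorem eq_algebraMap_of_sigma_mem_idealAlgebra [I.IsTwoSided]
    (hI : IsClosed (I : Set (reducedGroupCStar Γ H))) (hI_top : I ≠ ⊤) (f : StrongDual ℂ A)
    (hf : ∀ a : A, f (star a * a) = 0 → a = 0)
    (hΦσ : ∀ (a : A) (h : sigma α π a ∈ reducedCrossedProduct α π), Φ ⟨sigma α π a, h⟩ = f a • 1)
    (hΦC : ∀ (c : reducedGroupCStar Γ H)
      (h : (c : EllTwo Γ H →L[ℂ] EllTwo Γ H) ∈ reducedCrossedProduct α π), Φ ⟨c, h⟩ = c)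
    (hΦ : ∀ (c d : reducedGroupCStar Γ H) (x : reducedCrossedProduct α π)
      (h : (c : EllTwo Γ H →L[ℂ] EllTwo Γ H) * x * d ∈ reducedCrossedProduct α π),
      Φ ⟨c * x * d, h⟩ = c * Φ x * d)
    {a : A} (ha : sigma α π a ∈ idealAlgebra α π I) : a = algebraMap ℂ A (f a) := by
  have h1 := (mem_idealAlgebra_iff hI hΦC hΦ
    ⟨sigma α π a, sigma_mem_reducedCrossedProduct α π a⟩).1 ha
  rw [hΦσ] at h1
  set b := a - algebraMap ℂ A (f a) with hb
  have h2 : sigma α π b ∈ (idealSpan α π I).topologicalClosure := by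
    rw [hb, map_sub, AlgHomClass.commutes, Algebra.algebraMap_eq_smul_one]
    exact h1
  -- Faithfulness only detects positive elements, so `b` is replaced by `b⋆b`. Its image under `Φ`
  -- is a scalar in `I`, hence zero, as a nonzero one would be invertible.
  have h3 : sigma α π (star b * b) ∈ (idealSpan α π I).topologicalClosure := by
    rw [map_mul, map_star]
    exact mul_mem_idealSpan_closure (star_mem_idealSpan_closure hI h2) h2
  have h4 := expectation_mem_ideal hI hΦ ⟨_, sigma_mem_reducedCrossedProduct α π _⟩ h3
  rw [hΦσ] at h4
  have h5 : f (star b * b) = 0 := by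
    by_contra h0
    refine hI_top ((Ideal.eq_top_iff_one I).2 ?_)
    have h6 := I.mul_mem_left ((f (star b * b))⁻¹ • 1) h4
    rwa [smul_mul_smul_comm, inv_mul_cancel₀ h0, one_mul, one_smul] at h6
  exact sub_eq_zero.1 (hf b h5)

theorem subCrossedProduct_le_reducedGroupCStar {S : NonUnitalStarSubalgebra ℂ A}
    (hS : ∀ b ∈ S, ∃ z : ℂ, algebraMap ℂ A z = b) :
    (subCrossedProduct α π S : Set (EllTwo Γ H →L[ℂ] EllTwo Γ H)) ⊆ reducedGroupCStar Γ H := by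
  have h : subCrossedProduct α π S ≤ (reducedGroupCStar Γ H).toSubalgebra.toSubmodule := by
    refine Submodule.topologicalClosure_minimal _ (Submodule.span_le.2 ?_)
      (isClosed_reducedGroupCStar Γ H)
    rintro _ ⟨b, hb, s, rfl⟩
    obtain ⟨z, rfl⟩ := hS b hb
    rw [AlgHomClass.commutes]
    exact mul_mem (S := StarSubalgebra ℂ (EllTwo Γ H →L[ℂ] EllTwo Γ H))
      (algebraMap_mem (reducedGroupCStar Γ H) z) (leftReg_mem_reducedGroupCStar s)
  exact h

end Main

end

theorem mainTheorem4 {Γ : Type*} [Group Γ] (hΓ : IsICC Γ)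
    {A : Type*} [CStarAlgebra A] [PartialOrder A] [StarOrderedRing A]
    (hA : ¬ Function.Surjective (algebraMap ℂ A))
    (α : Γ →* (A ≃⋆ₐ[ℂ] A))
    (φ : A →ₚ[ℂ] ℂ) (hφ_one : φ 1 = 1)
    (hφ_faithful : ∀ a : A, 0 ≤ a → φ a = 0 → a = 0)
    (hφ_inv : ∀ (g : Γ) (a : A), φ (α g a) = φ a)
    {H : Type*} [NormedAddCommGroup H] [InnerProductSpace ℂ H] [CompleteSpace H]
    (π : A →⋆ₐ[ℂ] (H →L[ℂ] H)) (hπ : Function.Injective π)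
    (I : Ideal (reducedGroupCStar Γ H)) (hI_two : I.IsTwoSided)
    (hI_closed : IsClosed (I : Set (reducedGroupCStar Γ H)))
    (hI_bot : I ≠ ⊥) (hI_top : I ≠ ⊤) :
    ∃ B : StarSubalgebra ℂ (EllTwo Γ H →L[ℂ] EllTwo Γ H),
      -- the vector space `C⋆_r(Γ) + closure A_I` is a C⋆-algebra `B`
      (B : Set (EllTwo Γ H →L[ℂ] EllTwo Γ H)) = idealAlgebra α π I ∧
      IsClosed (B : Set (EllTwo Γ H →L[ℂ] EllTwo Γ H)) ∧
      -- it lies strictly between `C⋆_r(Γ)` and `A ⋊_r Γ`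
      reducedGroupCStar Γ H < B ∧ B < reducedCrossedProduct α π ∧
      -- it meets `A` in the scalars only
      B ⊓ (sigma α π).range = ⊥ ∧
      -- the image of `A_I`, hence that of `B`, under the canonical expectation is dense in `A`
      Dense (canonicalExpectation α hπ '' {x | (x : EllTwo Γ H →L[ℂ] EllTwo Γ H) ∈
        idealSpan α π I}) ∧
      Dense (canonicalExpectation α hπ '' {x | (x : EllTwo Γ H →L[ℂ] EllTwo Γ H) ∈ B}) ∧
      -- it is not the crossed product of any `Γ`-invariant C⋆-subalgebra of `A`
      ∀ S : NonUnitalStarSubalgebra ℂ A, IsClosed (S : Set A) →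
        (∀ (g : Γ), ∀ b ∈ S, α g b ∈ S) →
        (B : Set (EllTwo Γ H →L[ℂ] EllTwo Γ H)) ≠ subCrossedProduct α π S := by
  have hstar (a : A) (h : φ (star a * a) = 0) : a = 0 :=
    CStarRing.star_mul_self_eq_zero_iff a |>.1 (hφ_faithful _ (star_mul_self_nonneg a) h)
  -- Positive functionals on a C⋆-algebra are automatically bounded.
  let f : StrongDual ℂ A := ⟨φ.toLinearMap, map_continuous φ⟩
  obtain ⟨Φ, hΦσ, hΦC, hΦ⟩ := exists_expectation_reducedGroupCStar α hπ f hφ_inv hφ_one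
  have hscalar (a : A) (ha : sigma α π a ∈ idealAlgebra α π I) : a = algebraMap ℂ A (f a) :=
    eq_algebraMap_of_sigma_mem_idealAlgebra hI_closed hI_top f hstar hΦσ hΦC hΦ ha
  have hdense := dense_canonicalExpectation_idealSpan (α := α) hΓ hπ hI_bot
  have hdenseB := hdense.mono (Set.image_mono (f := canonicalExpectation α hπ)
    (fun x (hx : (x : EllTwo Γ H →L[ℂ] EllTwo Γ H) ∈ idealSpan α π I) =>
      show (x : EllTwo Γ H →L[ℂ] EllTwo Γ H) ∈ idealStarSubalgebra α π I hI_closed from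
        idealSpan_le_idealAlgebra hx))
  have hnle : ¬ idealStarSubalgebra α π I hI_closed ≤ reducedGroupCStar Γ H :=
    not_le_reducedGroupCStar_of_dense hA hπ hdenseB
  refine ⟨idealStarSubalgebra α π I hI_closed, rfl, isClosed_idealAlgebra hI_closed hΦC hΦ,
    lt_of_le_not_ge (reducedGroupCStar_le_idealStarSubalgebra hI_closed) hnle,
    lt_of_le_not_ge (idealStarSubalgebra_le_reducedCrossedProduct hI_closed) fun hle => ?_,
    ?_, hdense, hdenseB, fun S _ _ hS => ?_⟩
  · exact hA fun a => ⟨_, (hscalar a (hle (sigma_mem_reducedCrossedProduct α π a))).symm⟩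
  · refine le_bot_iff.1 ?_
    rintro _ ⟨hT, a, rfl⟩
    have ha := hscalar a hT
    refine StarSubalgebra.mem_bot.2 ⟨f a, ?_⟩
    change _ = sigma α π a
    rw [← AlgHomClass.commutes (sigma α π), ← ha]
  -- Taking `s = 1` in the generators of `S ⋊_r Γ` shows `σ(S) ⊆ B`, so `S` consists of scalars and
  -- `S ⋊_r Γ ⊆ C⋆_r(Γ)`.
  · refine hnle ?_
    rw [← SetLike.coe_subset_coe, hS]
    refine subCrossedProduct_le_reducedGroupCStar fun b hb => ⟨f b, (hscalar b ?_).symm⟩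
    have h1 : sigma α π b ∈ (subCrossedProduct α π S : Set (EllTwo Γ H →L[ℂ] EllTwo Γ H)) :=
      Submodule.le_topologicalClosure _ (Submodule.subset_span ⟨b, hb, 1, by simp⟩)
    rw [← hS] at h1
    exact h1
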